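/- A skew brace is a set $B$ with two group structures $(B,+)$ (not necessarily commutative) and $(B,\circ)$ such that $a\circ(b+c)=a\circ b-a+a\circ c$. Put $\lambda_a(b)=-a+a\circ b$ and $a\ast b=\lambda_a(b)-b$. A skew sub-brace is a subset that is a subgroup for both operations. A left ideal of a skew brace $C$ is a subgroup $I$ of $(C,+)$ with $\lambda_a(I)\subseteq I$ for all $a\in C$; it is strong if it is normal in $(C,+)$. Put $C^1=C$ and $C^{n+1}=\langle C\ast C^n\rangle_+$. We say that $C$ is left nilpotent of class $k$ if $k$ is the least integer with $C^{k+1}=\{0\}$, and strongly left nilpotent of class $k$ if $k$ is the least integer such that there is a chain $\{0\}=I_0<I_1<\dots<I_k=C$ of strong left ideals of $C$ with $C\ast I_{n+1}\subseteq I_n$ for all $n<k$. Let $\mathcal L=\{+,\circ,{}^{-1},-,0\}$. A skew brace $B$ is $\kappa$-stable ($\kappa$ an infinite cardinal) if over every model of $\mathrm{Th}(B)$ of cardinality $\kappa$ there are exactly $\kappa$ complete types; it is stable if it is $\kappa$-stable for some infinite $\kappa$, and $\omega$-stable if it is $\aleph_0$-stable. For a subset $A$ of $B$, the hull $\overline A^+$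 (resp. $\overline A^\circ$) is the intersection of all subgroups of $(B,+)$ (resp. $(B,\circ)$) that contain $A$ and are definable with parameters. In an elementary extension $B'$ of $B$ the hulls of $A$ are formed in $B'$, with $A$ unchanged. A hull is called type-definable (resp. definable) if there is one set of formulas (resp. one formula) over $B$ that defines it in every elementary extension of $B$. Theorem. Let $B$ be a stable skew brace and let $C$ be a left nilpotent (resp. strongly left nilpotent) skew sub-brace of $B$ of class $k$. Then there is a chain $\{0\}=I_0<I_1<\dots<I_k=C$ of left ideals (resp. strong left ideals) of $C$ with $C\ast I_{n+1}\subseteq I_n$ for all $n<k$ such that the following hold in $B$, and also in every elementary extension of $B$ (with hulls formed there): 1. $\overline C^+=\overline C^\circ=:\overline C$, and $\overline{I_n}^+=\overline{I_n}^\circ=:\overline I_n$ for all $n\le k$. 2. $\overline C$ is a left nilpotent (resp. strongly left nilpotent) skew sub-brace of class $k$. 3. $\{0\}=\overline I_0<\overline I_1<\dots<\overline I_k=\overline C$ is a chain of left ideals (resp. strong left ideals) of $\overline C$ with $\overline C\ast\overline I_{n+1}\subseteq\overline I_n$ for all $n<k$. Moreover $\overline C$ and all $\overline I_n$ are type-definable,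 and if $B$ is $\omega$-stable they are definable. -/

import Mathlib

open FirstOrder Cardinal

universe u

/-- A skew (left) brace: the additive group is `(B, +)`, written additively but not assumed to be
commutative, and the multiplicative group is `(B, *)`; `*` plays the role of `∘`. -/
class SkewBrace (B : Type u) extends AddGroup B, Group B where
  skew_distrib : ∀ a b c : B, a * (b + c) = a * b + -a + a * c

namespace SkewBrace

section Algebra

variable {B : Type u} [SkewBrace B]

/-- `λ_a(b) = -a + a ∘ b`. -/
def lam (a b : B) : B := -a + a * b

/-- `a ∗ b = λ_a(b) - b = -a + a ∘ b - b`. -/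
def ast (a b : B) : B := lam a b + -b

end Algebra

/-- A skew sub-brace: a subset which is a subgroup both of `(B, +)` and of `(B, ∘)`. -/
structure SkewSubbrace (B : Type u) [SkewBrace B] extends AddSubgroup B, Subgroup B

namespace SkewSubbrace

variable {B : Type u} [SkewBrace B]

/-- `I` is a left ideal of the skew brace `C`: an additive subgroup of `C` with
`λ_a(I) ⊆ I` for all `a ∈ C`. -/
def IsLeftIdeal (C : SkewSubbrace B) (I : AddSubgroup B) : Prop :=
  I ≤ C.toAddSubgroup ∧ ∀ a ∈ C.carrier, ∀ x ∈ I, lam a x ∈ I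

/-- `I` is a strong left ideal of `C`: a left ideal of `C` which is normal in `(C, +)`. -/
def IsStrongLeftIdeal (C : SkewSubbrace B) (I : AddSubgroup B) : Prop :=
  C.IsLeftIdeal I ∧ ∀ a ∈ C.carrier, ∀ x ∈ I, a + x + -a ∈ I

/-- The left series of `C`, with index shifted by one: `C.leftSeries n` is `C^(n+1)`, where
`C^1 = C` and `C^(n+1)` is the additive subgroup generated by `C ∗ C^n`. -/
def leftSeries (C : SkewSubbrace B) : ℕ → AddSubgroup B
  | 0 => C.toAddSubgroup
  | n + 1 => AddSubgroup.closure {z | ∃ a ∈ C.carrier, ∃ x ∈ C.leftSeries n, ast a x = z}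

/-- `C` is left nilpotent of class `k`: `C^(k+1) = 0`, and `k` is least with this property. -/
def IsLeftNilpotentOfClass (C : SkewSubbrace B) (k : ℕ) : Prop :=
  C.leftSeries k = ⊥ ∧ ∀ j < k, C.leftSeries j ≠ ⊥

/-- `{0} = I 0 < I 1 < ⋯ < I k = C` is a chain of left ideals of `C` with
`C ∗ I (n+1) ⊆ I n` for all `n < k`. -/
def IsLeftChain (C : SkewSubbrace B) (k : ℕ) (I : ℕ → AddSubgroup B) : Prop :=
  I 0 = ⊥ ∧ I k = C.toAddSubgroup ∧ (∀ n < k, I n < I (n + 1)) ∧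
    (∀ n ≤ k, C.IsLeftIdeal (I n)) ∧
    ∀ n < k, ∀ a ∈ C.carrier, ∀ x ∈ I (n + 1), ast a x ∈ I n

/-- `{0} = I 0 < I 1 < ⋯ < I k = C` is a chain of strong left ideals of `C` with
`C ∗ I (n+1) ⊆ I n` for all `n < k`. -/
def IsStrongLeftChain (C : SkewSubbrace B) (k : ℕ) (I : ℕ → AddSubgroup B) : Prop :=
  C.IsLeftChain k I ∧ ∀ n ≤ k, C.IsStrongLeftIdeal (I n)

/-- `C` is strongly left nilpotent of class `k`: `C` has a chain of strong left ideals as above of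
length `k`, and none of smaller length. -/
def IsStronglyLeftNilpotentOfClass (C : SkewSubbrace B) (k : ℕ) : Prop :=
  (∃ I, C.IsStrongLeftChain k I) ∧ ∀ j < k, ¬ ∃ I, C.IsStrongLeftChain j I

end SkewSubbrace

/-- The function symbols `+, ∘, ⁻¹, -, 0` of the language of skew braces. -/
inductive Func : ℕ → Type
  | add : Func 2
  | mul : Func 2
  | inv : Func 1
  | neg : Func 1
  | zero : Func 0

/-- The first-order language `{+, ∘, ⁻¹, -, 0}` of skew braces. -/
def lang : FirstOrder.Language.{0, 0} where
  Functions := Func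
  Relations := fun _ => Empty

/-- Every skew brace is a structure for the language of skew braces. -/
instance langStructure (B : Type u) [SkewBrace B] : lang.Structure B where
  funMap := fun {_} f =>
    match f with
    | .add => fun v => v 0 + v 1
    | .mul => fun v => v 0 * v 1
    | .inv => fun v => (v 0)⁻¹
    | .neg => fun v => -(v 0)
    | .zero => fun _ => 0
  RelMap := fun r _ => nomatch r

/-- `B` is `κ`-stable: over every model `A` of `Th(B)` of cardinality `κ` there are exactly `κ`
complete types (in finitely many variables). -/
def IsLambdaStable (κ : Cardinal.{u}) (B : Type u) [SkewBrace B] : Prop :=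
  ∀ (A : Type u) [lang.Structure A], A ⊨ lang.completeTheory B → #A = κ →
    #(Σ n : ℕ, (lang.elementaryDiagram A).CompleteType (Fin n)) = κ

/-- `B` is stable: it is `κ`-stable for some infinite cardinal `κ`. -/
def IsStable (B : Type u) [SkewBrace B] : Prop :=
  ∃ κ : Cardinal.{u}, ℵ₀ ≤ κ ∧ IsLambdaStable κ B

/-- `B` is `ω`-stable, that is, `ℵ₀`-stable. -/
def IsOmegaStable (B : Type u) [SkewBrace B] : Prop :=
  IsLambdaStable ℵ₀ B

section Hulls

variable {B : Type u} [SkewBrace B]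

/-- The additive definable hull of `S` in `B`: the intersection of all additive subgroups of `B`
containing `S` that are definable with parameters in `B`. -/
def addHull (S : Set B) : AddSubgroup B :=
  sInf {H : AddSubgroup B | (Set.univ : Set B).Definable₁ lang (H : Set B) ∧ S ⊆ (H : Set B)}

/-- The multiplicative definable hull of `S` in `B`: the intersection of all multiplicative
subgroups of `B` containing `S` that are definable with parameters in `B`. -/
def mulHull (S : Set B) : Subgroup B :=
  sInf {H : Subgroup B | (Set.univ : Set B).Definable₁ lang (H : Set B) ∧ S ⊆ (H : Set B)}

/-- A set `Φ` of formulas in one variable with parameters in `B` defines, in the elementary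
extension `j : B ↪ₑ B'`, the set of common realisations of the formulas in `Φ`. -/
def solutions (Φ : Set (lang.Formula (B ⊕ Unit))) {B' : Type u} [SkewBrace B']
    (j : B ↪ₑ[lang] B') : Set B' :=
  {x | ∀ φ ∈ Φ, φ.Realize (Sum.elim (fun b : B => j b) (fun _ : Unit => x))}

/-- The additive definable hull of `S ⊆ B` is type-definable over `B`: one and the same set of
formulas with parameters in `B` defines it in every elementary extension of `B`. Here `S` is a fixed
set of parameters which does not change when passing to an elementary extension. (Inside the single
structure `B` the notion would be void: every subset is an intersection of cofinite ones.) -/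
def HullIsTypeDefinable (S : Set B) : Prop :=
  ∃ Φ : Set (lang.Formula (B ⊕ Unit)), ∀ (B' : Type u) [SkewBrace B'] (j : B ↪ₑ[lang] B'),
    (addHull (j '' S) : Set B') = solutions Φ j

/-- The additive definable hull of `S ⊆ B` is definable over `B`: one and the same formula
with parameters in `B` defines it in every elementary extension of `B`. -/
def HullIsDefinable (S : Set B) : Prop :=
  ∃ φ : lang.Formula (B ⊕ Unit), ∀ (B' : Type u) [SkewBrace B'] (j : B ↪ₑ[lang] B'),
    (addHull (j '' S) : Set B') = solutions {φ} j

end Hulls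

end SkewBrace

open SkewBrace

/-! Stability enters only through type counting. A formula with the order property would index a
linear order of more than `κ` points that is separated by `κ` of them, and so yield too many types
(`IsStable.not_hasOrderProperty`). Without the order property, Baldwin–Saxl makes any intersection
of a uniformly definable family of subgroups a finite one, hence definable
(`IsStable.definable_iInter`).

Let `J ≤ T` be consecutive members of the chain, with `J` normal in `T`, and let `H` be definable
and contain `J`. Intersecting the preimages of `H` under all `λ_a` (`a ∈ C`) followed by conjugation
by elements of `T` gives a definable `L` between `J` and `H` that is still invariant. The normalizer
and the `λ`-stabilizer of `L` are definable, and so are `M`, the elements of the normalizer fixed by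
`C` modulo `L`, and `D`, the elements of the stabilizer acting trivially on `M` modulo `L`. As `M`
and `D` contain `T` and `C`, they contain the respective hulls. Letting `H` vary, invariance,
normality and `C ∗ T ⊆ J` all pass to hulls.

The two hulls agree because `x ∘ y ≡ x + y` modulo `L` for `x ∈ D`, `y ∈ M`. So a definable subgroup
for one operation that contains `T` can be cut down or corrected by `L` to one for the other
operation. From multiplicative to additive this needs `L` inside the given subgroup, which is
supplied by induction along the chain.

The argument applies to the image of `C` in any elementary extension, which is again stable. The
class cannot drop, since the hull contains the image of `C`; minimality of the class then makes the
chain of hulls strict. In the left nilpotent case the chain is the left series, whose terms are each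
normal in the preceding one; in the strong case any chain of length `k` will do.

For type-definability, a definable subgroup of an extension has a definable trace on `B`, and the
formula for this trace defines a smaller subgroup of the extension
(`IsStable.exists_mem_subgroupFormulas`). In the `ω`-stable case the descending chain condition
(`IsOmegaStable.not_strictAnti`) leaves a single formula. -/

open SkewBrace

/-! ### Ramsey's theorem, the order property and Baldwin–Saxl. -/

section Combinatorics

/-- Ramsey's theorem for pairs of natural numbers and two colours. -/
theorem exists_strictMono_forall_or_forall_not (c : ℕ → ℕ → Prop) :
    ∃ f : ℕ → ℕ, StrictMono f ∧
      ((∀ i j, i < j → c (f i) (f j)) ∨ ∀ i j, i < j → ¬ c (f i) (f j)) := by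
  have key : ∀ c : ℕ → ℕ → Prop,
      (∀ᶠ i in (Filter.hyperfilter ℕ : Filter ℕ), ∀ᶠ j in (Filter.hyperfilter ℕ : Filter ℕ), c i j) →
      ∃ f : ℕ → ℕ, StrictMono f ∧ ∀ i j, i < j → c (f i) (f j) := by
    intro c hc
    -- Greedy choice: each chosen `i` has ultrafilter-many good successors, and finitely many such
    -- sets still meet.
    obtain ⟨f, -, hf⟩ := exists_seq_of_forall_finset_exists
      (fun i => ∀ᶠ j in (Filter.hyperfilter ℕ : Filter ℕ), c i j) (fun i j => i < j ∧ c i j) (by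
        intro s hs
        have h1 : ∀ᶠ j in (Filter.hyperfilter ℕ : Filter ℕ), ∀ i ∈ s, i < j ∧ c i j := by
          rw [Filter.eventually_all_finset]
          intro i hi
          refine Filter.Eventually.and ?_ (hs i hi)
          exact Nat.hyperfilter_le_atTop (Filter.eventually_gt_atTop i)
        obtain ⟨y, hy⟩ := (hc.and h1).exists
        exact ⟨y, hy⟩)
    exact ⟨f, strictMono_nat_of_lt_succ fun n => (hf n (n + 1) (Nat.lt_succ_self n)).1,
      fun i j hij => (hf i j hij).2⟩
  by_cases h : ∀ᶠ i in (Filter.hyperfilter ℕ : Filter ℕ),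
      ∀ᶠ j in (Filter.hyperfilter ℕ : Filter ℕ), c i j
  · obtain ⟨f, hf, hc⟩ := key c h
    exact ⟨f, hf, Or.inl hc⟩
  · simp only [← Ultrafilter.eventually_not] at h
    obtain ⟨f, hf, hc⟩ := key (fun i j => ¬ c i j) h
    exact ⟨f, hf, Or.inr hc⟩

/-- A relation has the order property if it contains arbitrarily long finite half graphs. -/
def HasOrderProperty {X Y : Type*} (R : X → Y → Prop) : Prop :=
  ∀ N : ℕ, ∃ (x : ℕ → X) (y : ℕ → Y), ∀ i < N, ∀ j < N, (R (x i) (y j) ↔ i < j)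

theorem HasOrderProperty.of_lt {X Y : Type*} {R : X → Y → Prop} (x : ℕ → X) (y : ℕ → Y)
    (h : ∀ i j, R (x i) (y j) ↔ i < j) : HasOrderProperty R :=
  fun _ => ⟨x, y, fun i _ j _ => h i j⟩

theorem HasOrderProperty.of_le {X Y : Type*} {R : X → Y → Prop} (x : ℕ → X) (y : ℕ → Y)
    (h : ∀ i j, R (x i) (y j) ↔ i ≤ j) : HasOrderProperty R :=
  fun _ => ⟨fun i => x (i + 1), y, fun i _ j _ => h (i + 1) j⟩

theorem HasOrderProperty.of_gt {X Y : Type*} {R : X → Y → Prop} (x : ℕ → X) (y : ℕ → Y)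
    (h : ∀ i j, R (x i) (y j) ↔ j < i) : HasOrderProperty R :=
  fun N => ⟨fun i => x (N - i), fun j => y (N - j), fun i hi j hj => by rw [h]; omega⟩

theorem HasOrderProperty.of_comp {X Y X' Y' : Type*} {R : X → Y → Prop} (a : X' → X) (b : Y' → Y)
    (h : HasOrderProperty fun x y => R (a x) (b y)) : HasOrderProperty R := fun N => by
  obtain ⟨x, y, hxy⟩ := h N
  exact ⟨a ∘ x, b ∘ y, hxy⟩

/-- Under a relation without the order property, a sequence of uniformly definable subgroups
cannot be separated from a sequence of elements in a triangular way. -/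
theorem HasOrderProperty.of_triangular {X Y : Type*} [AddGroup X] {R : X → Y → Prop}
    (g : ℕ → X) (H : ℕ → AddSubgroup X) (y : ℕ → Y) (hH : ∀ i x, x ∈ H i ↔ R x (y i))
    (hg : ∀ i, g i ∉ H i)
    (hgH : (∀ i j, i < j → g i ∈ H j) ∨ (∀ i j, j < i → g i ∈ H j)) :
    HasOrderProperty R := by
  -- In the diagonal situation partial sums give a half graph: `g 0 + ⋯ + g (n - 1)` leaves `H j`
  -- when `g j` is added and never returns.
  have sums : ∀ (g : ℕ → X) (H : ℕ → AddSubgroup X) (y : ℕ → Y)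
      (_ : ∀ i x, x ∈ H i ↔ R x (y i)), (∀ i j, g i ∈ H j ↔ i ≠ j) → HasOrderProperty R := by
    intro g H y hH h
    let s : ℕ → X := fun n => Nat.rec 0 (fun k t => t + g k) n
    have s_succ : ∀ n, s (n + 1) = s n + g n := fun n => rfl
    have s_mem : ∀ n j, s n ∈ H j ↔ n ≤ j := by
      intro n j
      induction n with
      | zero => simp [s]
      | succ n ih =>
        rw [s_succ]
        rcases eq_or_ne n j with rfl | hne
        · have h1 : s n ∈ H n := ih.2 le_rfl
          rw [AddSubgroup.add_mem_cancel_left _ h1, h]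
          simp
        · rw [AddSubgroup.add_mem_cancel_right _ ((h n j).2 hne), ih]
          omega
    exact HasOrderProperty.of_le s y fun i j => by rw [← hH, s_mem]
  -- One half of the matrix is known. Ramsey makes the other half constant: full gives the diagonal
  -- situation, empty is already a half graph.
  rcases hgH with hgH | hgH
  · obtain ⟨f, hf, hc | hc⟩ := exists_strictMono_forall_or_forall_not fun i j => g j ∈ H i
    · refine sums (g ∘ f) (H ∘ f) (y ∘ f) (fun i x => hH _ x) fun i j => ⟨?_, fun hne => ?_⟩
      · rintro hi rfl
        exact hg _ hi
      · rcases hne.lt_or_gt with hlt | hlt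
        · exact hgH _ _ (hf hlt)
        · exact hc _ _ hlt
    · refine HasOrderProperty.of_lt (g ∘ f) (y ∘ f) fun i j => ?_
      rw [Function.comp, Function.comp, ← hH]
      refine ⟨fun hi => ?_, fun hlt => hgH _ _ (hf hlt)⟩
      rcases lt_trichotomy i j with hlt | rfl | hlt
      · exact hlt
      · exact absurd hi (hg _)
      · exact absurd hi (hc _ _ hlt)
  · obtain ⟨f, hf, hc | hc⟩ := exists_strictMono_forall_or_forall_not fun i j => g i ∈ H j
    · refine sums (g ∘ f) (H ∘ f) (y ∘ f) (fun i x => hH _ x) fun i j => ⟨?_, fun hne => ?_⟩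
      · rintro hi rfl
        exact hg _ hi
      · rcases hne.lt_or_gt with hlt | hlt
        · exact hc _ _ hlt
        · exact hgH _ _ (hf hlt)
    · refine HasOrderProperty.of_gt (g ∘ f) (y ∘ f) fun i j => ?_
      rw [Function.comp, Function.comp, ← hH]
      refine ⟨fun hi => ?_, fun hlt => hgH _ _ (hf hlt)⟩
      rcases lt_trichotomy i j with hlt | rfl | hlt
      · exact absurd hi (hc _ _ hlt)
      · exact absurd hi (hg _)
      · exact hlt

/-- Baldwin–Saxl: without the order property, every intersection of subgroups from a uniformly
definable family is a finite subintersection. -/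
theorem exists_finset_subintersection {X Y : Type*} [AddGroup X] {R : X → Y → Prop}
    (hR : ¬ HasOrderProperty R) (T : Set Y) (H : Y → AddSubgroup X)
    (hH : ∀ y ∈ T, ∀ x, x ∈ H y ↔ R x y) :
    ∃ F : Finset Y, (F : Set Y) ⊆ T ∧ ∀ x, (∀ y ∈ F, x ∈ H y) → ∀ y ∈ T, x ∈ H y := by
  classical
  by_contra hcon
  push Not at hcon
  -- Each new pair violates its own subgroup but lies in all earlier ones, a triangular
  -- configuration.
  obtain ⟨f, hP, hr⟩ := exists_seq_of_forall_finset_exists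
    (fun p : X × Y => p.2 ∈ T ∧ p.1 ∉ H p.2) (fun p q => q.1 ∈ H p.2) (by
      intro s hs
      obtain ⟨x, hx, y, hy, hxy⟩ := hcon (s.image Prod.snd) (by
        intro y hy
        simp only [Finset.coe_image, Set.mem_image, SetLike.mem_coe] at hy
        obtain ⟨p, hp, rfl⟩ := hy
        exact (hs p hp).1)
      exact ⟨(x, y), ⟨hy, hxy⟩, fun p hp => hx _ (Finset.mem_image_of_mem _ hp)⟩)
  exact hR (HasOrderProperty.of_triangular (fun n => (f n).1) (fun n => H (f n).2)
    (fun n => (f n).2) (fun i x => hH _ (hP i).1 x) (fun i => (hP i).2)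
    (Or.inr fun i j hij => hr j i hij))

/-- Without the order property, a set all of whose finite traces are traces of sets `R · y` is a
Boolean combination of finitely many sets `R · y`. -/
theorem exists_finset_boolean_combination {X Y : Type*} {R : X → Y → Prop}
    (hR : ¬ HasOrderProperty R) (S : Set X)
    (hS : ∀ F : Finset X, ∃ y, ∀ x ∈ F, (x ∈ S ↔ R x y)) :
    ∃ F : Finset Y, ∀ x x', (∀ y ∈ F, (R x y ↔ R x' y)) → (x ∈ S ↔ x' ∈ S) := by
  classical
  by_contra hcon
  have hcon' : ∀ F : Finset Y, ∃ x x', (∀ y ∈ F, (R x y ↔ R x' y)) ∧ x ∈ S ∧ x' ∉ S := by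
    intro F
    by_contra h
    push Not at h
    exact hcon ⟨F, fun x x' hxx => ⟨h x x' hxx, h x' x fun y hy => (hxx y hy).symm⟩⟩
  -- The triples consist of `x ∈ S` and `x' ∉ S` that no earlier parameter separates, and a
  -- parameter `y` agreeing with `S` on these and all earlier points. Ramsey then finds a half graph
  -- among the `x'` or among the `x`.
  obtain ⟨f, hP, hr⟩ := exists_seq_of_forall_finset_exists
    (fun p : X × X × Y => p.1 ∈ S ∧ p.2.1 ∉ S ∧ R p.1 p.2.2 ∧ ¬ R p.2.1 p.2.2)
    (fun p q => (R q.1 p.2.2 ↔ R q.2.1 p.2.2) ∧ R p.1 q.2.2 ∧ ¬ R p.2.1 q.2.2) (by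
      intro s hs
      obtain ⟨x, x', hxx, hx, hx'⟩ := hcon' (s.image fun p => p.2.2)
      obtain ⟨y, hy⟩ := hS ({x, x'} ∪ (s.image fun p => p.1) ∪ s.image fun p => p.2.1)
      refine ⟨(x, x', y), ⟨hx, hx', (hy x (by simp)).1 hx, fun h => hx' ((hy x' (by simp)).2 h)⟩,
        fun p hp => ⟨hxx _ (Finset.mem_image_of_mem _ hp), ?_, fun h => ?_⟩⟩
      · refine (hy _ ?_).1 (hs p hp).1
        exact Finset.mem_union_left _ (Finset.mem_union_right _ (Finset.mem_image_of_mem _ hp))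
      · refine (hs p hp).2.1 ((hy _ ?_).2 h)
        exact Finset.mem_union_right _ (Finset.mem_image_of_mem (fun p : X × X × Y => p.2.1) hp))
  obtain ⟨e, he, hc | hc⟩ := exists_strictMono_forall_or_forall_not
    fun i j => R (f j).1 (f i).2.2
  · refine hR (HasOrderProperty.of_gt (fun n => (f (e n)).2.1) (fun n => (f (e n)).2.2) ?_)
    intro i j
    refine ⟨fun h => ?_, fun h => (hr _ _ (he h)).1.1 (hc _ _ h)⟩
    rcases lt_trichotomy i j with hlt | rfl | hlt
    · exact absurd h (hr _ _ (he hlt)).2.2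
    · exact absurd h (hP _).2.2.2
    · exact hlt
  · refine hR (HasOrderProperty.of_le (fun n => (f (e n)).1) (fun n => (f (e n)).2.2) ?_)
    intro i j
    refine ⟨fun h => ?_, fun h => ?_⟩
    · by_contra hlt
      exact hc _ _ (not_le.1 hlt) h
    · rcases h.lt_or_eq with hlt | rfl
      · exact (hr _ _ (he hlt)).2.1
      · exact (hP _).2.2.1

end Combinatorics

/-! ### Counting types: stability excludes the order property. -/

section Types

theorem SkewBrace.card_lang_le : lang.card ≤ ℵ₀ := by
  have hF : Countable (Σ n, Func n) := by
    refine Function.Injective.countable (f := fun p : Σ n, Func n => (match p with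
      | ⟨_, Func.add⟩ => 0 | ⟨_, Func.mul⟩ => 1 | ⟨_, Func.inv⟩ => 2 | ⟨_, Func.neg⟩ => 3
      | ⟨_, Func.zero⟩ => 4 : ℕ)) ?_
    rintro ⟨_, _ | _⟩ ⟨_, _ | _⟩ h <;> simp_all
  have hR : IsEmpty (Σ n, lang.Relations n) := ⟨fun p => p.2.elim⟩
  have : Countable lang.Symbols := by
    change Countable ((Σ n, Func n) ⊕ (Σ n, lang.Relations n))
    infer_instance
  exact mk_le_aleph0

/-- A formula depends on finitely many of its variables. -/
theorem SkewBrace.exists_finset_formula {V : Type*} (φ : lang.Formula (V ⊕ Unit)) :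
    ∃ (s : Finset V) (ψ : lang.Formula (s ⊕ Unit)), ∀ (M : Type u) [lang.Structure M]
      (v : V → M) (x : Unit → M),
      ψ.Realize (Sum.elim (fun i => v i) x) ↔ φ.Realize (Sum.elim v x) := by
  classical
  refine ⟨φ.freeVarFinset.toLeft, φ.restrictFreeVar fun i => match i with
    | ⟨Sum.inl a, h⟩ => Sum.inl ⟨a, Finset.mem_toLeft.2 h⟩
    | ⟨Sum.inr b, _⟩ => Sum.inr b, fun M _ v x => ?_⟩
  refine Language.BoundedFormula.realize_restrictFreeVar _ ?_
  rintro ⟨a | b, h⟩ <;> rfl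

/-- In a `κ`-stable theory, a family of elements of a model that is separated by formulas over at
most `κ` parameters has at most `κ` members. -/
theorem SkewBrace.IsLambdaStable.mk_le {κ : Cardinal.{u}} (hκ : ℵ₀ ≤ κ) {B : Type u} [SkewBrace B]
    (h : IsLambdaStable κ B) {N : Type u} [lang.Structure N] [Nonempty N]
    (hN : N ⊨ lang.completeTheory B) (P : Set N) (hP : #P ≤ κ) {X : Type u} (c : X → N)
    (sep : ∀ f g, f ≠ g → ∃ (V : Type u) (φ : lang.Formula (V ⊕ Unit)) (v : V → N),
      (∀ i, v i ∈ P) ∧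
        ¬ (φ.Realize (Sum.elim v fun _ => c f) ↔ φ.Realize (Sum.elim v fun _ => c g))) :
    #X ≤ κ := by
  by_contra hX
  have c_inj : Function.Injective c := by
    intro f g hfg
    by_contra hne
    obtain ⟨V, φ, v, -, hφ⟩ := sep f g hne
    rw [hfg] at hφ
    exact hφ Iff.rfl
  -- Löwenheim–Skolem gives a model of size exactly `κ` around `P`; the points `c f` have distinct
  -- types over it.
  obtain ⟨S, hPS, hS⟩ := Language.exists_elementarySubstructure_card_eq lang P κ hκ
    (by simpa using hP) (by simpa using (lift_le.{u}.2 card_lang_le).trans (by simpa using hκ))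
    (by simpa using (not_le.1 hX).le.trans (mk_le_of_injective c_inj))
  have hS' : #S = κ := by simpa using hS
  have hcard := h S ((S.theory_model_iff _).2 hN) hS'
  let _ : (Language.constantsOn S).Structure N := Language.constantsOn.structure (fun s : S => (s : N))
  have con_eq : ∀ s : S, ((lang.con s : lang[[S]].Constants) : N) = s := fun s => rfl
  have hmodel : N ⊨ lang.elementaryDiagram S := by
    rw [Language.Theory.model_iff]
    intro ψ hψ
    rw [Language.mem_completeTheory] at hψ
    rw [← Language.Formula.realize_equivSentence_symm_con] at hψ ⊢
    rw [← S.subtype.map_formula] at hψ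
    exact hψ
  let tp : X → Σ n : ℕ, (lang.elementaryDiagram S).CompleteType (Fin n) :=
    fun f => ⟨1, (lang.elementaryDiagram S).typeOf (fun _ => c f)⟩
  have tp_inj : Function.Injective tp := by
    intro f g hfg
    by_contra hne
    obtain ⟨V, φ, v, hv, hφ⟩ := sep f g hne
    apply hφ
    let φ' : lang.Formula (S ⊕ Fin 1) :=
      φ.relabel (Sum.map (fun i => (⟨v i, hPS (hv i)⟩ : S)) (fun _ => 0))
    let ψ : lang[[S]].Formula (Fin 1) := Language.BoundedFormula.constantsVarsEquiv.symm φ'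
    have hψ : ∀ x : N, ψ.Realize (fun _ => x) ↔ φ.Realize (Sum.elim v fun _ => x) := by
      intro x
      rw [Language.Formula.Realize, ← Language.BoundedFormula.realize_constantsVarsEquiv,
        Equiv.apply_symm_apply]
      change φ'.Realize _ ↔ _
      rw [Language.Formula.realize_relabel]
      refine iff_of_eq (congrArg φ.Realize ?_)
      ext i
      rcases i with i | i <;> rfl
    have h1 : (lang.elementaryDiagram S).typeOf (fun _ : Fin 1 => c f) =
        (lang.elementaryDiagram S).typeOf (fun _ : Fin 1 => c g) := by
      simpa [tp] using hfg
    rw [← hψ, ← hψ, ← Language.Theory.CompleteType.formula_mem_typeOf (T := lang.elementaryDiagram S),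
      h1, Language.Theory.CompleteType.formula_mem_typeOf]
  exact hX ((mk_le_of_injective tp_inj).trans hcard.le)

/-- For every infinite cardinal `κ` there is a linear order with more than `κ` elements in which some
`κ` many elements separate any two. -/
theorem exists_linearOrder_separated (κ : Cardinal.{u}) (hκ : ℵ₀ ≤ κ) :
    ∃ (L : Type u) (_ : LinearOrder L) (J : Set L), #J ≤ κ ∧ κ < #L ∧
      ∀ f g : L, f < g → ∃ h ∈ J, f < h ∧ h ≤ g := by
  have hne : {μ : Cardinal.{u} | κ < 2 ^ μ}.Nonempty := ⟨κ, cantor κ⟩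
  -- For the least `μ` with `κ < 2 ^ μ`, the lexicographic order on `2 ^ μ` is large, while
  -- minimality leaves at most `κ` sequences that vanish beyond some index.
  obtain ⟨μ, hμ, hmin⟩ := WellFounded.has_min Cardinal.lt_wf _ hne
  have hμκ : μ ≤ κ := not_lt.1 fun h => hmin κ (cantor κ) h
  let I := μ.ord.ToType
  have hI : #I = μ := by simp [I]
  refine ⟨Lex (I → Bool), inferInstance,
    Set.range (fun p : Σ i : I, (Set.Iic i → Bool) => toLex fun j =>
      if h : j ≤ p.1 then p.2 ⟨j, h⟩ else false), ?_, ?_, ?_⟩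
  · refine mk_range_le.trans ?_
    rw [mk_sigma]
    have hle : ∀ i : I, #(Set.Iic i → Bool) ≤ κ := by
      intro i
      have hμ' : ℵ₀ ≤ μ := not_lt.1 fun h =>
        absurd hμ (not_lt.2 ((power_lt_aleph0 (natCast_lt_aleph0 (n := 2)) h).le.trans hκ))
      have hlt : #(Set.Iic i) < μ := by
        rw [← Set.Iio_insert]
        exact (mk_insert_le).trans_lt
          (add_lt_of_lt hμ' ((mk_Iio_lt i (by simp [I])).trans_eq hI) (one_lt_aleph0.trans_le hμ'))
      simp only [mk_pi, mk_bool, prod_const, lift_ofNat, lift_uzero]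
      exact not_lt.1 fun h => hmin _ h hlt
    calc Cardinal.sum (fun i : I => #(Set.Iic i → Bool)) ≤ Cardinal.sum (fun _ : I => κ) :=
          sum_le_sum _ _ hle
      _ = μ * κ := by simp [hI]
      _ ≤ κ * κ := mul_le_mul_left hμκ _
      _ = κ := mul_eq_self hκ
  · change κ < #(I → Bool)
    simpa [hI] using hμ
  · intro f g hfg
    obtain ⟨i, hi, hlt⟩ := hfg
    have hlt' : ofLex f i < ofLex g i := hlt
    have hfi : ofLex f i = false := (Bool.lt_iff.1 hlt').1
    have hgi : ofLex g i = true := (Bool.lt_iff.1 hlt').2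
    -- The separator is `g` cut off after the first index where it differs from `f`.
    refine ⟨_, ⟨⟨i, fun j => ofLex g j⟩, rfl⟩, ?_, ?_⟩
    · refine ⟨i, fun j hj => ?_, ?_⟩
      · have := hi j hj
        simpa [hj.le] using this
      · simpa using hlt
    · apply Pi.toLex_monotone (a := fun j => if h : j ≤ i then ofLex g j else false)
      intro j
      by_cases h : j ≤ i <;> simp [h]

/-- In a stable skew brace no formula has the order property. -/
theorem SkewBrace.IsStable.not_hasOrderProperty {B : Type u} [SkewBrace B] (hB : IsStable B)
    {V : Type u} (φ : lang.Formula (V ⊕ Unit)) :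
    ¬ HasOrderProperty fun (x : B) (v : V → B) => φ.Realize (Sum.elim v fun _ => x) := by
  intro hR
  obtain ⟨κ, hκ, hstab⟩ := hB
  -- With finitely many variables each index contributes finitely many parameters, so `κ` indices
  -- use at most `κ` parameters.
  obtain ⟨s, ψ, hψ⟩ := exists_finset_formula φ
  obtain ⟨L, _, J, hJ, hL, hsep⟩ := exists_linearOrder_separated κ hκ
  -- A finite subset of `L` is represented by a half graph in `B` through the rank of its elements.
  have hlad : ∀ F : Finset L, ∃ (x : L → B) (y : L → V → B), ∀ f ∈ F, ∀ g ∈ F,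
      (φ.Realize (Sum.elim (y g) fun _ => x f) ↔ f < g) := by
    intro F
    obtain ⟨x, y, hxy⟩ := hR F.card
    classical
    have hrank : ∀ f ∈ F, (F.filter (· < f)).card < F.card := fun f hf =>
      Finset.card_lt_card (Finset.filter_ssubset.2 ⟨f, hf, lt_irrefl f⟩)
    refine ⟨fun f => x (F.filter (· < f)).card, fun f => y (F.filter (· < f)).card,
      fun f hf g hg => ?_⟩
    refine (hxy _ (hrank f hf) _ (hrank g hg)).trans ?_
    refine ⟨fun h => ?_, fun h => Finset.card_lt_card ?_⟩
    · by_contra hfg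
      refine absurd h (not_lt.2 (Finset.card_le_card fun a ha => ?_))
      rw [Finset.mem_filter] at ha ⊢
      exact ⟨ha.1, ha.2.trans_le (not_lt.1 hfg)⟩
    · refine Finset.ssubset_iff_of_subset (fun a ha => ?_) |>.2 ⟨f, by simp [hf, h], by simp⟩
      rw [Finset.mem_filter] at ha ⊢
      exact ⟨ha.1, ha.2.trans h⟩
  choose x y hxy using hlad
  -- Almost every finite set contains a given pair `f, g`, so the ultrapower represents all of `L`
  -- at once.
  let U : Ultrafilter (Finset L) := Ultrafilter.of Filter.atTop
  let N := (U : Filter (Finset L)).Product fun _ => B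
  let c : L → N := fun f => (fun F => x F f : ∀ _ : Finset L, B)
  let d : L → s → N := fun g i => (fun F => y F g i : ∀ _ : Finset L, B)
  have hN : N ⊨ lang.completeTheory B := by
    rw [Language.Theory.model_iff]
    intro θ hθ
    exact (Language.Ultraproduct.sentence_realize θ).2 (Filter.Eventually.of_forall fun _ => hθ)
  have hreal : ∀ f g, ψ.Realize (Sum.elim (d g) fun _ => c f) ↔ f < g := by
    intro f g
    have h1 := Language.Ultraproduct.realize_formula_cast (u := U) (M := fun _ : Finset L => B) ψ
      (Sum.elim (fun i F => y F g i) fun _ F => x F f)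
    have h2 : (fun i => ((Sum.elim (fun (i : s) F => y F g i) (fun _ F => x F f) :
        s ⊕ Unit → Finset L → B) i : N)) = Sum.elim (d g) fun _ => c f := by
      ext i
      rcases i with i | i <;> rfl
    rw [← h2]
    refine h1.trans ?_
    have hev : ∀ᶠ F in (U : Filter (Finset L)),
        ((ψ.Realize fun i => (Sum.elim (fun (i : s) F => y F g i) (fun _ F => x F f) :
        s ⊕ Unit → Finset L → B) i F) ↔ f < g) := by
      refine Ultrafilter.of_le Filter.atTop ?_
      filter_upwards [Filter.eventually_ge_atTop {f, g}] with F hF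
      rw [← hxy F f (hF (by simp)) g (hF (by simp)), ← hψ]
      refine iff_of_eq (congrArg ψ.Realize ?_)
      ext i
      rcases i with i | i <;> rfl
    rw [Filter.eventually_congr hev, Filter.eventually_const]
  refine absurd (hstab.mk_le hκ hN (⋃ g : J, Set.range (d g)) ?_ c ?_) (not_le.2 hL)
  · refine (mk_iUnion_le_sum_mk).trans ?_
    calc Cardinal.sum (fun g : J => #(Set.range (d g))) ≤ Cardinal.sum (fun _ : J => ℵ₀) :=
          sum_le_sum _ _ fun g => mk_range_le.trans (by simp)
      _ = #J * ℵ₀ := by simp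
      _ ≤ κ * κ := mul_le_mul' hJ hκ
      _ = κ := mul_eq_self hκ
  · have key : ∀ f g, f < g → ∃ (V : Type u) (φ : lang.Formula (V ⊕ Unit)) (v : V → N),
        (∀ i, v i ∈ ⋃ g : J, Set.range (d g)) ∧
        ¬ (φ.Realize (Sum.elim v fun _ => c f) ↔ φ.Realize (Sum.elim v fun _ => c g)) := by
      intro f g hfg
      obtain ⟨h, hJ, hfh, hhg⟩ := hsep f g hfg
      refine ⟨s, ψ, d h, fun i => Set.mem_iUnion.2 ⟨⟨h, hJ⟩, i, rfl⟩, ?_⟩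
      rw [hreal, hreal]
      simp [hfh, not_lt.2 hhg]
    intro f g hne
    rcases hne.lt_or_gt with h | h
    · exact key f g h
    · obtain ⟨V, φ, v, hv, hφ⟩ := key g f h
      exact ⟨V, φ, v, hv, fun h => hφ h.symm⟩

end Types

namespace SkewBrace

/-! ### Definability with parameters, and definable intersections. -/

section Definability

/-- The symbol for addition. -/
def addSymbol : lang.Functions 2 := Func.add

/-- The symbol for the circle operation. -/
def mulSymbol : lang.Functions 2 := Func.mul

/-- The symbol for the additive inverse. -/
def negSymbol : lang.Functions 1 := Func.neg

theorem realize_addSymbol {B : Type u} [SkewBrace B] {α : Type*} (t s : lang.Term α) (v : α → B) :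
    (addSymbol.apply₂ t s).realize v = t.realize v + s.realize v :=
  Language.Term.realize_functions_apply₂

theorem realize_mulSymbol {B : Type u} [SkewBrace B] {α : Type*} (t s : lang.Term α) (v : α → B) :
    (mulSymbol.apply₂ t s).realize v = t.realize v * s.realize v :=
  Language.Term.realize_functions_apply₂

theorem realize_negSymbol {B : Type u} [SkewBrace B] {α : Type*} (t : lang.Term α) (v : α → B) :
    (negSymbol.apply₁ t).realize v = -t.realize v :=
  Language.Term.realize_functions_apply₁

variable {B : Type u} [SkewBrace B]

/-- A map `(α → B) → B` given by a term with parameters. -/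
def IsTermMap {α : Type} (f : (α → B) → B) : Prop :=
  ∃ t : lang.Term (B ⊕ α), ∀ v, t.realize (Sum.elim id v) = f v

/-- A predicate on tuples that is given by a formula with parameters. -/
def DefinablePred {α : Type} (P : (α → B) → Prop) : Prop :=
  ∃ φ : lang.Formula (B ⊕ α), ∀ v, φ.Realize (Sum.elim id v) ↔ P v

variable {α : Type} {f g : (α → B) → B} {P Q : (α → B) → Prop}

theorem IsTermMap.var (i : α) : IsTermMap fun v : α → B => v i :=
  ⟨Language.Term.var (Sum.inr i), fun _ => rfl⟩

theorem IsTermMap.add (hf : IsTermMap f) (hg : IsTermMap g) : IsTermMap fun v => f v + g v := by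
  obtain ⟨t, ht⟩ := hf
  obtain ⟨s, hs⟩ := hg
  exact ⟨addSymbol.apply₂ t s, fun v => by rw [realize_addSymbol, ht, hs]⟩

theorem IsTermMap.mul (hf : IsTermMap f) (hg : IsTermMap g) : IsTermMap fun v => f v * g v := by
  obtain ⟨t, ht⟩ := hf
  obtain ⟨s, hs⟩ := hg
  exact ⟨mulSymbol.apply₂ t s, fun v => by rw [realize_mulSymbol, ht, hs]⟩

theorem IsTermMap.neg (hf : IsTermMap f) : IsTermMap fun v => -f v := by
  obtain ⟨t, ht⟩ := hf
  exact ⟨negSymbol.apply₁ t, fun v => by rw [realize_negSymbol, ht]⟩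

theorem IsTermMap.lam (hf : IsTermMap f) (hg : IsTermMap g) :
    IsTermMap fun v => SkewBrace.lam (f v) (g v) :=
  hf.neg.add (hf.mul hg)

theorem DefinablePred.and (hP : DefinablePred P) (hQ : DefinablePred Q) :
    DefinablePred fun v => P v ∧ Q v := by
  obtain ⟨φ, hφ⟩ := hP
  obtain ⟨ψ, hψ⟩ := hQ
  exact ⟨φ ⊓ ψ, fun v => by rw [Language.Formula.realize_inf, hφ, hψ]⟩

theorem DefinablePred.not (hP : DefinablePred P) : DefinablePred fun v => ¬ P v := by
  obtain ⟨φ, hφ⟩ := hP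
  exact ⟨φ.not, fun v => by rw [Language.Formula.realize_not, hφ]⟩

theorem DefinablePred.imp (hP : DefinablePred P) (hQ : DefinablePred Q) :
    DefinablePred fun v => P v → Q v := by
  obtain ⟨φ, hφ⟩ := hP
  obtain ⟨ψ, hψ⟩ := hQ
  exact ⟨φ.imp ψ, fun v => by rw [Language.Formula.realize_imp, hφ, hψ]⟩

theorem DefinablePred.iff (hP : DefinablePred P) (hQ : DefinablePred Q) :
    DefinablePred fun v => (P v ↔ Q v) := by
  obtain ⟨φ, hφ⟩ := hP
  obtain ⟨ψ, hψ⟩ := hQ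
  exact ⟨φ.iff ψ, fun v => by rw [Language.Formula.realize_iff, hφ, hψ]⟩

theorem DefinablePred.finset_forall {ι : Type*} (F : Finset ι) {P : ι → (α → B) → Prop}
    (hP : ∀ i ∈ F, DefinablePred (P i)) : DefinablePred fun v => ∀ i ∈ F, P i v := by
  choose φ hφ using hP
  exact ⟨Language.Formula.iInf fun i : F => φ i i.2, fun v => by
    rw [Language.Formula.realize_iInf]
    exact ⟨fun h i hi => (hφ i hi v).1 (h ⟨i, hi⟩), fun h i => (hφ i i.2 v).2 (h i i.2)⟩⟩

/-- A subset of `B` is definable with parameters. -/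
theorem definable₁_iff {S : Set B} : (Set.univ : Set B).Definable₁ lang S ↔
    ∃ φ : lang.Formula (B ⊕ Unit), ∀ x, φ.Realize (Sum.elim id fun _ => x) ↔ x ∈ S := by
  rw [Set.Definable₁, Set.definable_iff_exists_formula_sum]
  constructor
  · rintro ⟨φ, hφ⟩
    refine ⟨φ.relabel (Sum.map (fun b => b.1) fun _ => ()), fun x => ?_⟩
    rw [Language.Formula.realize_relabel]
    have := Set.ext_iff.1 hφ fun _ => x
    refine Iff.trans ?_ this.symm
    refine iff_of_eq (congrArg φ.Realize ?_)
    ext i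
    rcases i with i | i <;> rfl
  · rintro ⟨φ, hφ⟩
    refine ⟨φ.relabel (Sum.map (fun b => ⟨b, trivial⟩) fun _ => 0), Set.ext fun v => ?_⟩
    refine (hφ (v 0)).symm.trans (Iff.trans ?_ Language.Formula.realize_relabel.symm)
    refine iff_of_eq (congrArg φ.Realize ?_)
    ext i
    rcases i with i | i <;> rfl

theorem DefinablePred.definable₁ {P : B → Prop} {i : α} (h : DefinablePred fun v : α → B => P (v i)) :
    (Set.univ : Set B).Definable₁ lang {x | P x} := by
  obtain ⟨φ, hφ⟩ := h
  refine definable₁_iff.2 ⟨φ.relabel (Sum.map id fun _ => ()), fun x => ?_⟩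
  rw [Language.Formula.realize_relabel]
  refine Iff.trans ?_ (hφ fun _ => x)
  refine iff_of_eq (congrArg φ.Realize ?_)
  ext i
  rcases i with i | i <;> rfl

theorem IsTermMap.mem {S : Set B} (hf : IsTermMap f) (hS : (Set.univ : Set B).Definable₁ lang S) :
    DefinablePred fun v => f v ∈ S := by
  obtain ⟨t, ht⟩ := hf
  obtain ⟨φ, hφ⟩ := definable₁_iff.1 hS
  refine ⟨φ.subst (Sum.elim (fun b => Language.Term.var (Sum.inl b)) fun _ => t), fun v => ?_⟩
  change _ ↔ f v ∈ S
  rw [← hφ, Language.Formula.Realize, Language.BoundedFormula.realize_subst, ← ht]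
  refine iff_of_eq (congrArg (fun w => Language.BoundedFormula.Realize φ w default) ?_)
  ext i
  rcases i with i | i <;> rfl

theorem DefinablePred.exists_snd {P : B → B → Prop}
    (h : DefinablePred fun v : Fin 2 → B => P (v 0) (v 1)) :
    (Set.univ : Set B).Definable₁ lang {x | ∃ y, P x y} := by
  obtain ⟨φ, hφ⟩ := h
  let φ' : lang.Formula ((B ⊕ Unit) ⊕ Unit) :=
    φ.relabel (Sum.elim (fun b => Sum.inl (Sum.inl b)) ![Sum.inl (Sum.inr ()), Sum.inr ()])
  refine definable₁_iff.2 ⟨φ'.iExs Unit, fun x => ?_⟩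
  rw [Language.Formula.realize_iExs]
  have key : ∀ y : Unit → B,
      φ'.Realize (Sum.elim (Sum.elim id fun _ => x) y) ↔ P x (y ()) := by
    intro y
    rw [Language.Formula.realize_relabel]
    refine Iff.trans ?_ (hφ ![x, y ()])
    refine iff_of_eq (congrArg φ.Realize ?_)
    ext i
    rcases i with i | i
    · rfl
    · fin_cases i <;> rfl
  simp only [key]
  exact ⟨fun ⟨y, hy⟩ => ⟨_, hy⟩, fun ⟨y, hy⟩ => ⟨fun _ => y, hy⟩⟩

theorem DefinablePred.forall_snd {P : B → B → Prop}
    (h : DefinablePred fun v : Fin 2 → B => P (v 0) (v 1)) :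
    (Set.univ : Set B).Definable₁ lang {x | ∀ y, P x y} := by
  have h1 : DefinablePred fun v : Fin 1 → B => v 0 ∈ {x | ∃ y, ¬ P x y} :=
    (IsTermMap.var 0).mem (DefinablePred.exists_snd (P := fun x y => ¬ P x y) h.not)
  have h2 := h1.not
  simp only [Set.mem_ofPred_eq, not_exists, not_not] at h2
  exact h2.definable₁ (P := fun x => ∀ y, P x y)

/-- In a stable skew brace, the intersection of a family of uniformly definable subgroups is
definable. -/
theorem IsStable.definable_iInter (hB : IsStable B) (H : B → B → AddSubgroup B)
    (hH : DefinablePred fun v : Fin 3 → B => v 2 ∈ H (v 0) (v 1)) (T : Set (B × B)) :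
    (Set.univ : Set B).Definable₁ lang {x | ∀ p ∈ T, x ∈ H p.1 p.2} := by
  obtain ⟨φ, hφ⟩ := hH
  let φ' : lang.Formula ((B ⊕ Fin 2) ⊕ Unit) := φ.relabel (Sum.elim (fun b => Sum.inl (Sum.inl b))
    ![Sum.inl (Sum.inr 0), Sum.inl (Sum.inr 1), Sum.inr ()])
  have hφ' : ∀ (p : B × B) (x : B),
      φ'.Realize (Sum.elim (Sum.elim id ![p.1, p.2]) fun _ => x) ↔ x ∈ H p.1 p.2 := by
    intro p x
    rw [Language.Formula.realize_relabel]
    refine Iff.trans ?_ (hφ ![p.1, p.2, x])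
    refine iff_of_eq (congrArg φ.Realize ?_)
    ext i
    rcases i with i | i
    · rfl
    · fin_cases i <;> rfl
  have hR : ¬ HasOrderProperty fun (x : B) (p : B × B) => x ∈ H p.1 p.2 := by
    intro h
    refine hB.not_hasOrderProperty φ' (HasOrderProperty.of_comp id
      (fun p : B × B => Sum.elim id ![p.1, p.2]) ?_)
    simpa only [id, hφ'] using h
  -- Baldwin–Saxl replaces `T` by a finite `F`, so that a finite conjunction defines the
  -- intersection.
  obtain ⟨F, hF, hFT⟩ := exists_finset_subintersection hR T (fun p => H p.1 p.2)
    fun _ _ _ => Iff.rfl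
  have h1 : DefinablePred fun v : Fin 1 → B => ∀ p ∈ F, v 0 ∈ H p.1 p.2 := by
    refine DefinablePred.finset_forall F fun p _ => ?_
    refine ⟨φ.relabel (Sum.elim Sum.inl ![Sum.inl p.1, Sum.inl p.2, Sum.inr 0]), fun v => ?_⟩
    rw [Language.Formula.realize_relabel]
    refine Iff.trans ?_ (hφ ![p.1, p.2, v 0])
    refine iff_of_eq (congrArg φ.Realize ?_)
    ext i
    rcases i with i | i
    · rfl
    · fin_cases i <;> rfl
  have h2 : {x | ∀ p ∈ T, x ∈ H p.1 p.2} = {x | ∀ p ∈ F, x ∈ H p.1 p.2} :=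
    Set.ext fun x => ⟨fun h p hp => h p (hF hp), fun h => hFT x h⟩
  rw [h2]
  exact h1.definable₁ (P := fun x => ∀ p ∈ F, x ∈ H p.1 p.2)

end Definability

end SkewBrace

namespace SkewBrace

/-! ### Hulls in elementary extensions and type-definability. -/

section Extensions

/-- The formula expressing that `θ(v, ·)` is an additive subgroup. -/
noncomputable def isSubgroupFormula {V : Type*} (θ : lang.Formula (V ⊕ Unit)) : lang.Formula V :=
  θ.iExs Unit ⊓ Language.Formula.iAlls (Fin 3)
    ((Language.Term.equal (Language.Term.var (Sum.inr 2))
      (addSymbol.apply₂ (Language.Term.var (Sum.inr 0))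
        (negSymbol.apply₁ (Language.Term.var (Sum.inr 1)))) : lang.Formula (V ⊕ Fin 3)).imp
    ((θ.relabel (Sum.map id fun _ => 0)).imp
      ((θ.relabel (Sum.map id fun _ => 1)).imp (θ.relabel (Sum.map id fun _ => 2)))))

theorem realize_isSubgroupFormula {V : Type*} (θ : lang.Formula (V ⊕ Unit)) {B : Type u}
    [SkewBrace B] (v : V → B) : (isSubgroupFormula θ).Realize v ↔
      ∃ K : AddSubgroup B, ∀ x, θ.Realize (Sum.elim v fun _ => x) ↔ x ∈ K := by
  have hrel : ∀ (i : Fin 3) (w : Fin 3 → B),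
      (θ.relabel (Sum.map id fun _ => i) : lang.Formula (V ⊕ Fin 3)).Realize (Sum.elim v w) ↔
        θ.Realize (Sum.elim v fun _ => w i) := by
    intro i w
    rw [Language.Formula.realize_relabel]
    refine iff_of_eq (congrArg θ.Realize ?_)
    ext j
    rcases j with j | j <;> rfl
  have hex : (θ.iExs Unit).Realize v ↔ ∃ x, θ.Realize (Sum.elim v fun _ => x) := by
    rw [Language.Formula.realize_iExs]
    exact ⟨fun ⟨x, hx⟩ => ⟨x (), hx⟩, fun ⟨x, hx⟩ => ⟨fun _ => x, hx⟩⟩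
  rw [isSubgroupFormula, Language.Formula.realize_inf, hex, Language.Formula.realize_iAlls]
  simp only [Language.Formula.realize_imp, hrel, Language.Formula.realize_equal,
    realize_addSymbol, realize_negSymbol, Language.Term.realize_var, Sum.elim_inr]
  constructor
  · rintro ⟨⟨x₀, hx₀⟩, h⟩
    -- The third coordinate is tied to `x + -y` by an equation, so that `θ` need only be relabelled
    -- and not substituted into.
    have hsub : ∀ x y, θ.Realize (Sum.elim v fun _ => x) → θ.Realize (Sum.elim v fun _ => y) →
        θ.Realize (Sum.elim v fun _ => x + -y) := fun x y => h ![x, y, x + -y] rfl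
    have h0 : θ.Realize (Sum.elim v fun _ => (0 : B)) := by
      simpa using hsub x₀ x₀ hx₀ hx₀
    have hneg : ∀ y, θ.Realize (Sum.elim v fun _ => y) → θ.Realize (Sum.elim v fun _ => -y) :=
      fun y hy => by simpa using hsub 0 y h0 hy
    exact ⟨{ carrier := {x | θ.Realize (Sum.elim v fun _ => x)}
             zero_mem' := h0
             add_mem' := fun {x y} hx hy => by simpa using hsub x (-y) hx (hneg y hy)
             neg_mem' := fun {y} hy => hneg y hy }, fun x => Iff.rfl⟩
  · rintro ⟨K, hK⟩
    simp only [hK]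
    exact ⟨⟨0, K.zero_mem⟩, fun w hw h0 h1 => hw ▸ K.add_mem h0 (K.neg_mem h1)⟩

variable {B : Type u} [SkewBrace B]

/-- The formulas over `B` that define an additive subgroup of `B` containing `S`. -/
def subgroupFormulas (S : Set B) : Set (lang.Formula (B ⊕ Unit)) :=
  {θ | ∃ K : AddSubgroup B, S ⊆ K ∧ ∀ x, θ.Realize (Sum.elim id fun _ => x) ↔ x ∈ K}

variable {B' : Type u} [SkewBrace B'] (j : B ↪ₑ[lang] B')

theorem realize_sumElim_embedding (θ : lang.Formula (B ⊕ Unit)) (x : B) :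
    θ.Realize (Sum.elim j fun _ => j x) ↔ θ.Realize (Sum.elim id fun _ => x) := by
  rw [← j.map_formula]
  refine iff_of_eq (congrArg θ.Realize ?_)
  ext i
  rcases i with i | i <;> rfl

/-- An elementary embedding as an additive homomorphism. -/
def addHomOfEmbedding : B →+ B' :=
  AddMonoidHom.mk' j fun x y => j.map_fun addSymbol ![x, y]

theorem definable₁_realize (θ : lang.Formula (B ⊕ Unit)) :
    (Set.univ : Set B').Definable₁ lang {x | θ.Realize (Sum.elim j fun _ => x)} := by
  refine definable₁_iff.2 ⟨θ.relabel (Sum.map j id), fun x => ?_⟩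
  rw [Language.Formula.realize_relabel]
  refine iff_of_eq (congrArg θ.Realize ?_)
  ext i
  rcases i with i | i <;> rfl

/-- Being a subgroup is a first-order property of the parameters, so it passes to the extension
along with membership of each element of `S`. -/
theorem exists_addSubgroup_of_mem_subgroupFormulas {S : Set B} {θ : lang.Formula (B ⊕ Unit)}
    (hθ : θ ∈ subgroupFormulas S) : ∃ K : AddSubgroup B', (Set.univ : Set B').Definable₁ lang K ∧
      j '' S ⊆ K ∧ ∀ x, θ.Realize (Sum.elim j fun _ => x) ↔ x ∈ K := by
  obtain ⟨K, hSK, hK⟩ := hθ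
  have h1 := (realize_isSubgroupFormula θ (id : B → B)).2 ⟨K, hK⟩
  rw [← j.map_formula, Function.comp_id, realize_isSubgroupFormula] at h1
  obtain ⟨K', hK'⟩ := h1
  refine ⟨K', ?_, ?_, hK'⟩
  · convert definable₁_realize j θ using 1
    ext x
    exact (hK' x).symm
  · rintro _ ⟨x, hx, rfl⟩
    exact (hK' _).1 ((realize_sumElim_embedding j θ x).2 ((hK x).2 (hSK hx)))

theorem realize_le_of_realize_le {θ₁ θ₂ : lang.Formula (B ⊕ Unit)}
    (h : ∀ x : B, θ₁.Realize (Sum.elim id fun _ => x) → θ₂.Realize (Sum.elim id fun _ => x))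
    (x : B') (hx : θ₁.Realize (Sum.elim j fun _ => x)) : θ₂.Realize (Sum.elim j fun _ => x) := by
  have h1 : ((θ₁.imp θ₂).iAlls Unit).Realize (id : B → B) := by
    rw [Language.Formula.realize_iAlls]
    exact fun y => h (y ())
  rw [← j.map_formula, Function.comp_id, Language.Formula.realize_iAlls] at h1
  exact h1 (fun _ => x) hx

/-- In a stable skew brace, a definable subgroup `H` of an elementary extension that contains a set
`S ⊆ B` contains a subgroup defined over `B` that contains `S`. -/
theorem IsStable.exists_mem_subgroupFormulas (hB : IsStable B) {S : Set B} (H : AddSubgroup B')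
    (hH : (Set.univ : Set B').Definable₁ lang (H : Set B')) (hS : j '' S ⊆ H) :
    ∃ θ ∈ subgroupFormulas S, ∀ x, θ.Realize (Sum.elim j fun _ => x) → x ∈ H := by
  classical
  obtain ⟨φ₀, hφ₀⟩ := definable₁_iff.1 hH
  obtain ⟨s, φ, hφ⟩ := exists_finset_formula φ₀
  let b : s → B' := fun i => i
  have hb : ∀ x, φ.Realize (Sum.elim b fun _ => x) ↔ x ∈ H := fun x => by
    rw [← SetLike.mem_coe, ← hφ₀]
    exact hφ B' id fun _ => x
  have hR := hB.not_hasOrderProperty φ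
  -- transfer of existential statements about the parameters of `H` to `B`
  have transfer : ∀ χ : lang.Formula (B ⊕ s), χ.Realize (Sum.elim j b) →
      ∃ v : s → B, χ.Realize (Sum.elim id v) := by
    intro χ hχ
    have h1 : (χ.iExs s).Realize (j ∘ id) := by
      rw [Language.Formula.realize_iExs]
      exact ⟨b, hχ⟩
    rwa [j.map_formula, Language.Formula.realize_iExs] at h1
  have hrel : ∀ {M : Type u} [SkewBrace M] (x : B) (e : B → M) (v : s → M),
      (φ.relabel (Sum.elim Sum.inr fun _ => Sum.inl x) : lang.Formula (B ⊕ s)).Realize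
        (Sum.elim e v) ↔ φ.Realize (Sum.elim v fun _ => e x) := by
    intro M _ x e v
    rw [Language.Formula.realize_relabel]
    refine iff_of_eq (congrArg φ.Realize ?_)
    ext j
    rcases j with j | j <;> rfl
  -- the trace of `H` on `B` is definable in `B`
  obtain ⟨F, hF⟩ := exists_finset_boolean_combination hR {x | j x ∈ H} (by
    intro F
    let χ : lang.Formula (B ⊕ s) := Language.Formula.iInf fun x : F =>
      if j x.1 ∈ H then φ.relabel (Sum.elim Sum.inr fun _ => Sum.inl x.1)
      else (φ.relabel (Sum.elim Sum.inr fun _ => Sum.inl x.1)).not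
    have hχ : χ.Realize (Sum.elim j b) := by
      rw [Language.Formula.realize_iInf]
      intro x
      split_ifs with hx
      · rwa [hrel, hb]
      · rwa [Language.Formula.realize_not, hrel, hb]
    obtain ⟨v, hv⟩ := transfer χ hχ
    refine ⟨v, fun x hx => ?_⟩
    have := (Language.Formula.realize_iInf.1 hv) ⟨x, hx⟩
    split_ifs at this with hxH
    · rw [hrel] at this
      exact iff_of_true hxH this
    · rw [Language.Formula.realize_not, hrel] at this
      exact iff_of_false hxH this)
  have htrace : ∃ θ : lang.Formula (B ⊕ Unit),
      ∀ x, θ.Realize (Sum.elim id fun _ => x) ↔ j x ∈ H := by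
    -- The patterns on the finitely many instances of `φ` that occur in the trace; there are
    -- finitely many, and the disjunction over them defines the trace.
    let A : Set (F → Prop) := {t | ∃ x, j x ∈ H ∧ ∀ y : F, t y ↔ φ.Realize (Sum.elim y.1 fun _ => x)}
    let inst : ∀ y : F, lang.Formula (B ⊕ Unit) := fun y =>
      φ.relabel (Sum.elim (fun i => Sum.inl (y.1 i)) Sum.inr)
    have hinst : ∀ y x, (inst y).Realize (Sum.elim id fun _ => x) ↔
        φ.Realize (Sum.elim y.1 fun _ => x) := by
      intro y x
      rw [Language.Formula.realize_relabel]
      refine iff_of_eq (congrArg φ.Realize ?_)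
      ext j
      rcases j with j | j <;> rfl
    refine ⟨Language.Formula.iSup fun t : A => Language.Formula.iInf fun y : F =>
      if t.1 y then inst y else (inst y).not, fun x => ?_⟩
    simp only [Language.Formula.realize_iSup, Language.Formula.realize_iInf]
    constructor
    · rintro ⟨⟨t, x', hx', ht⟩, h⟩
      refine (hF x' x fun y hy => ?_).1 hx'
      have h1 := h ⟨y, hy⟩
      have h2 := ht ⟨y, hy⟩
      split_ifs at h1 with hty
      · rw [hinst] at h1
        exact iff_of_true (h2.1 hty) h1
      · rw [Language.Formula.realize_not, hinst] at h1
        exact iff_of_false (fun h => hty (h2.2 h)) h1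
    · intro hx
      refine ⟨⟨fun y => φ.Realize (Sum.elim y.1 fun _ => x), x, hx, fun y => Iff.rfl⟩, fun y => ?_⟩
      split_ifs with hy
      · rwa [hinst]
      · rwa [Language.Formula.realize_not, hinst]
  obtain ⟨θ, hθ⟩ := htrace
  refine ⟨θ, ⟨H.comap (addHomOfEmbedding j), fun x hx => hS ⟨x, hx, rfl⟩, hθ⟩, ?_⟩
  by_contra hcon
  push Not at hcon
  obtain ⟨g, hgθ, hgH⟩ := hcon
  -- In the extension the parameters of `H` define a subgroup that omits a point of `θ` but contains
  -- the finitely many points chosen so far, since these lie in the trace. Elementarity gives such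
  -- parameters and such a point in `B`; iterating produces a triangular configuration.
  obtain ⟨f, hP, hr⟩ := exists_seq_of_forall_finset_exists
    (fun p : B × (s → B) => θ.Realize (Sum.elim id fun _ => p.1) ∧
      ¬ φ.Realize (Sum.elim p.2 fun _ => p.1) ∧ (isSubgroupFormula φ).Realize p.2)
    (fun p q => φ.Realize (Sum.elim q.2 fun _ => p.1)) (by
      intro t ht
      let χ₁ : lang.Formula (B ⊕ s) := Language.Formula.iExs Unit
        (θ.relabel (Sum.map Sum.inl id) ⊓ (φ.relabel (Sum.map Sum.inr id)).not)
      let χ₂ : lang.Formula (B ⊕ s) := (isSubgroupFormula φ).relabel Sum.inr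
      let χ₃ : lang.Formula (B ⊕ s) := Language.Formula.iInf fun p : t =>
        φ.relabel (Sum.elim Sum.inr fun _ => Sum.inl p.1.1)
      have h₁ : ∀ {M : Type u} [SkewBrace M] (e : B → M) (v : s → M),
          χ₁.Realize (Sum.elim e v) ↔ ∃ x, θ.Realize (Sum.elim e fun _ => x) ∧
            ¬ φ.Realize (Sum.elim v fun _ => x) := by
        intro M _ e v
        rw [Language.Formula.realize_iExs]
        have : ∀ w : Unit → M, ((θ.relabel (Sum.map Sum.inl id) ⊓
            (φ.relabel (Sum.map Sum.inr id)).not : lang.Formula ((B ⊕ s) ⊕ Unit)).Realize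
            (Sum.elim (Sum.elim e v) w)) ↔ θ.Realize (Sum.elim e fun _ => w ()) ∧
            ¬ φ.Realize (Sum.elim v fun _ => w ()) := by
          intro w
          rw [Language.Formula.realize_inf, Language.Formula.realize_not,
            Language.Formula.realize_relabel, Language.Formula.realize_relabel]
          refine and_congr (iff_of_eq (congrArg θ.Realize ?_))
            (not_congr (iff_of_eq (congrArg φ.Realize ?_)))
          all_goals
            ext i
            rcases i with i | i <;> rfl
        simp only [this]
        exact ⟨fun ⟨w, hw⟩ => ⟨_, hw⟩, fun ⟨x, hx⟩ => ⟨fun _ => x, hx⟩⟩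
      have h₂ : ∀ {M : Type u} [SkewBrace M] (e : B → M) (v : s → M),
          χ₂.Realize (Sum.elim e v) ↔ (isSubgroupFormula φ).Realize v := fun e v => by
        rw [Language.Formula.realize_relabel, Sum.elim_comp_inr]
      have h₃ : ∀ {M : Type u} [SkewBrace M] (e : B → M) (v : s → M),
          χ₃.Realize (Sum.elim e v) ↔ ∀ p ∈ t, φ.Realize (Sum.elim v fun _ => e p.1) := by
        intro M _ e v
        rw [Language.Formula.realize_iInf]
        simp only [hrel, Subtype.forall]
      obtain ⟨v, hv⟩ := transfer (χ₁ ⊓ χ₂ ⊓ χ₃) (by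
        rw [Language.Formula.realize_inf, Language.Formula.realize_inf, h₁, h₂, h₃]
        refine ⟨⟨⟨g, hgθ, fun h => hgH ((hb g).1 h)⟩,
          (realize_isSubgroupFormula φ b).2 ⟨H, hb⟩⟩, fun p hp => (hb _).2 ?_⟩
        exact (hθ _).1 (ht p hp).1)
      rw [Language.Formula.realize_inf, Language.Formula.realize_inf, h₁, h₂, h₃] at hv
      obtain ⟨⟨⟨x, hxθ, hxφ⟩, hsub⟩, hall⟩ := hv
      exact ⟨(x, v), ⟨hxθ, hxφ, hsub⟩, hall⟩)
  choose K hK using fun i => (realize_isSubgroupFormula φ (f i).2).1 (hP i).2.2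
  exact hR (HasOrderProperty.of_triangular (fun i => (f i).1) K (fun i => (f i).2)
    (fun i x => (hK i x).symm) (fun i h => (hP i).2.1 ((hK i _).2 h))
    (Or.inl fun i k hik => (hK k _).1 (hr i k hik)))

/-- In a stable skew brace the additive hull of a set in an elementary extension is the intersection
of the subgroups defined over `B` that contain the set. -/
theorem IsStable.addHull_image_eq (hB : IsStable B) (S : Set B) :
    (addHull (j '' S) : Set B') = solutions (subgroupFormulas S) j := by
  ext x
  constructor
  · intro hx θ hθ
    obtain ⟨K, hKd, hSK, hK⟩ := exists_addSubgroup_of_mem_subgroupFormulas j hθ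
    exact (hK x).2 (AddSubgroup.mem_sInf.1 hx K ⟨hKd, hSK⟩)
  · intro hx
    refine AddSubgroup.mem_sInf.2 fun H ⟨hH, hS⟩ => ?_
    obtain ⟨θ, hθ, hle⟩ := hB.exists_mem_subgroupFormulas j H hH hS
    exact hle x (hx θ hθ)

theorem IsStable.hullIsTypeDefinable (hB : IsStable B) (S : Set B) : HullIsTypeDefinable S :=
  ⟨subgroupFormulas S, fun _ _ j => hB.addHull_image_eq j S⟩

/-- The formula of the least subgroup implies every member of `subgroupFormulas S` in `B`, hence in
each elementary extension. -/
theorem IsStable.hullIsDefinable_of_isLeast (hB : IsStable B) {S : Set B}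
    (h : ∃ H : AddSubgroup B, IsLeast {H : AddSubgroup B |
      (Set.univ : Set B).Definable₁ lang (H : Set B) ∧ S ⊆ (H : Set B)} H) :
    HullIsDefinable S := by
  obtain ⟨H, ⟨hH, hSH⟩, hmin⟩ := h
  obtain ⟨θ, hθ⟩ := definable₁_iff.1 hH
  refine ⟨θ, fun B' _ j => ?_⟩
  rw [hB.addHull_image_eq j S]
  ext x
  constructor
  · rintro hx _ rfl
    exact hx _ ⟨H, hSH, hθ⟩
  · rintro hx χ ⟨K, hSK, hχ⟩
    refine realize_le_of_realize_le j (fun y hy => ?_) x (hx θ rfl)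
    exact (hχ y).2 (hmin ⟨definable₁_iff.2 ⟨χ, hχ⟩, hSK⟩ ((hθ y).1 hy))

end Extensions

/-! ### The descending chain condition under `ω`-stability. -/

section OmegaStable

variable {B : Type u} [SkewBrace B]

/-- An `ω`-stable skew brace has the descending chain condition on definable subgroups. -/
theorem IsOmegaStable.not_strictAnti (hB : IsOmegaStable B) (K : ℕ → AddSubgroup B)
    (hK : ∀ n, (Set.univ : Set B).Definable₁ lang (K n : Set B))
    (hlt : ∀ n, K (n + 1) < K n) : False := by
  classical
  choose a ha ha' using fun n => SetLike.exists_of_lt (hlt n)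
  -- A binary tree of cosets: with `a n ∈ K n` outside `K (n + 1)`, the partial sums along a branch
  -- `σ` stay from stage `n` on in the coset `s σ n + K n`.
  let s : (ℕ → Bool) → ℕ → B := fun σ n => Nat.rec 0 (fun m t => t + if σ m then a m else 0) n
  have s_succ : ∀ σ n, s σ (n + 1) = s σ n + if σ n then a n else 0 := fun _ _ => rfl
  have s_congr : ∀ σ τ n, (∀ m < n, σ m = τ m) → s σ n = s τ n := by
    intro σ τ n
    induction n with
    | zero => exact fun _ => rfl
    | succ n ih =>
      intro h
      rw [s_succ, s_succ, ih fun m hm => h m (hm.trans n.lt_succ_self), h n n.lt_succ_self]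
  have anti : Antitone K := antitone_nat_of_succ_le fun n => (hlt n).le
  have s_mem : ∀ σ n m, n ≤ m → -s σ n + s σ m ∈ K n := by
    intro σ n m hnm
    induction m, hnm using Nat.le_induction with
    | base => simp
    | succ m hnm ih =>
      rw [s_succ, ← add_assoc]
      refine add_mem ih ?_
      split_ifs
      · exact anti hnm (ha m)
      · exact zero_mem _
  choose φ₀ hφ₀ using fun n => definable₁_iff.1 (hK n)
  choose p φ hφ using fun n => exists_finset_formula (φ₀ n)
  let U : Ultrafilter ℕ := Filter.hyperfilter ℕ
  let N := (U : Filter ℕ).Product fun _ => B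
  let diag : B → N := fun b => (fun _ => b : ∀ _ : ℕ, B)
  -- In the ultrapower the class of the sequence of partial sums lies in all the cosets of its
  -- branch at once.
  let c : (ℕ → Bool) → N := fun σ => (s σ : ∀ _ : ℕ, B)
  have hN : N ⊨ lang.completeTheory B := by
    rw [Language.Theory.model_iff]
    intro θ hθ
    exact (Language.Ultraproduct.sentence_realize θ).2 (Filter.Eventually.of_forall fun _ => hθ)
  -- the formula `-z + x ∈ K n`
  let χ : ∀ n, lang.Formula (Option (p n) ⊕ Unit) := fun n => (φ n).subst (Sum.elim
    (fun i => Language.Term.var (Sum.inl (some i)))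
    fun _ => addSymbol.apply₂ (negSymbol.apply₁ (Language.Term.var (Sum.inl none)))
      (Language.Term.var (Sum.inr ())))
  let par : ∀ (n : ℕ), B → Option (p n) → B := fun n z o => o.elim z fun i => i
  have hχ : ∀ n z x, (χ n).Realize (Sum.elim (par n z) fun _ => x) ↔ -z + x ∈ K n := by
    intro n z x
    rw [← SetLike.mem_coe, ← hφ₀]
    refine Iff.trans ?_ (hφ n B id fun _ => -z + x)
    rw [Language.Formula.Realize, Language.BoundedFormula.realize_subst]
    refine iff_of_eq (congrArg (fun w => Language.BoundedFormula.Realize (φ n) w default) ?_)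
    ext i
    rcases i with i | i
    · rfl
    · simp only [Sum.elim_inr, realize_addSymbol, realize_negSymbol]
      rfl
  have hχN : ∀ n z σ, (χ n).Realize (Sum.elim (fun o => diag (par n z o)) fun _ => c σ) ↔
      ∀ᶠ m in (U : Filter ℕ), -z + s σ m ∈ K n := by
    intro n z σ
    have h1 := Language.Ultraproduct.realize_formula_cast (u := U) (M := fun _ : ℕ => B) (χ n)
      (Sum.elim (fun o _ => par n z o) fun _ => s σ)
    have h2 : (fun i => ((Sum.elim (fun o _ => par n z o) (fun _ => s σ) :
        Option (p n) ⊕ Unit → ℕ → B) i : N)) =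
        Sum.elim (fun o => diag (par n z o)) fun _ => c σ := by
      ext i
      rcases i with i | i <;> rfl
    rw [← h2]
    refine h1.trans (Filter.eventually_congr (Filter.Eventually.of_forall fun m => ?_))
    rw [← hχ]
    refine iff_of_eq (congrArg (χ n).Realize ?_)
    ext i
    rcases i with i | i <;> rfl
  -- the values of partial sums form a countable set
  let P : Set N := diag '' ((⋃ n, (p n : Set B)) ∪
    ⋃ n, Set.range fun t : Fin n → Bool => s (fun m => if h : m < n then t ⟨m, h⟩ else false) n)
  have hP : P.Countable := by
    refine Set.Countable.image (Set.Countable.union ?_ ?_) _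
    · exact Set.countable_iUnion fun n => (p n).countable_toSet
    · exact Set.countable_iUnion fun n => Set.countable_range _
  have hsP : ∀ σ n, diag (s σ n) ∈ P := by
    intro σ n
    refine ⟨_, Or.inr (Set.mem_iUnion.2 ⟨n, fun m => σ m, rfl⟩), ?_⟩
    refine congrArg diag (s_congr _ _ _ fun m hm => ?_)
    simp [hm]
  -- At the first difference the two partial sums differ by `a n`, so the branches enter different
  -- cosets of `K (n + 1)`.
  have key : ∀ σ τ n, (∀ m < n, σ m = τ m) → σ n = false → τ n = true →
      ((χ (n + 1)).Realize (Sum.elim (fun o => diag (par (n + 1) (s σ (n + 1)) o)) fun _ => c σ) ∧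
      ¬ (χ (n + 1)).Realize
        (Sum.elim (fun o => diag (par (n + 1) (s σ (n + 1)) o)) fun _ => c τ)) := by
    intro σ τ n hστ hσ hτ
    have hge : ∀ᶠ m in (U : Filter ℕ), n + 1 ≤ m :=
      Nat.hyperfilter_le_atTop (Filter.eventually_ge_atTop (n + 1))
    rw [hχN, hχN]
    refine ⟨hge.mono fun m hm => s_mem σ _ _ hm, fun hcon => ?_⟩
    obtain ⟨m, hm, hmem⟩ := (hge.and hcon).exists
    have h1 := s_mem τ (n + 1) m hm
    have h2 : -s σ (n + 1) + s τ (n + 1) ∈ K (n + 1) := by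
      have := sub_mem hmem h1
      simpa [sub_eq_add_neg, add_assoc] using this
    rw [s_succ, s_succ, s_congr σ τ n hστ, hσ, hτ] at h2
    simp at h2
    exact ha' n h2
  have := hB.mk_le le_rfl hN P (le_aleph0_iff_set_countable.2 hP)
    (fun σ : ULift.{u} (ℕ → Bool) => c σ.down) (by
      have sep : ∀ σ τ n, (∀ m < n, σ m = τ m) → σ n = false → τ n = true →
          ∃ (V : Type u) (φ : lang.Formula (V ⊕ Unit)) (v : V → N), (∀ i, v i ∈ P) ∧
          ¬ (φ.Realize (Sum.elim v fun _ => c σ) ↔ φ.Realize (Sum.elim v fun _ => c τ)) := by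
        intro σ τ n hστ hσ hτ
        obtain ⟨h1, h2⟩ := key σ τ n hστ hσ hτ
        refine ⟨_, χ (n + 1), fun o => diag (par (n + 1) (s σ (n + 1)) o), fun o => ?_,
          fun h => h2 (h.1 h1)⟩
        rcases o with _ | i
        · exact hsP σ (n + 1)
        · exact ⟨_, Or.inl (Set.mem_iUnion.2 ⟨n + 1, i.2⟩), rfl⟩
      rintro ⟨σ⟩ ⟨τ⟩ hne
      have hne' : ∃ n, σ n ≠ τ n := Function.ne_iff.1 fun h => hne (congrArg ULift.up h)
      have hmin : ∀ m < Nat.find hne', σ m = τ m := fun m hm =>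
        not_not.1 (Nat.find_min hne' hm)
      have hn := Nat.find_spec hne'
      cases h : σ (Nat.find hne') <;> cases h' : τ (Nat.find hne')
      · exact absurd (h.trans h'.symm) hn
      · exact sep σ τ _ hmin h h'
      · obtain ⟨V, φ, v, hv, hφ⟩ := sep τ σ _ (fun m hm => (hmin m hm).symm) h' h
        exact ⟨V, φ, v, hv, fun h => hφ h.symm⟩
      · exact absurd (h.trans h'.symm) hn)
  simp only [mk_uLift, mk_pi, mk_bool, prod_const, lift_uzero, mk_nat] at this
  exact absurd this (by simpa using cantor ℵ₀)

/-- The chain condition gives a minimal such subgroup; closure under intersection makes it least. -/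
theorem IsOmegaStable.exists_isLeast (hB : IsOmegaStable B) (S : Set B) :
    ∃ H : AddSubgroup B, IsLeast {H : AddSubgroup B |
      (Set.univ : Set B).Definable₁ lang (H : Set B) ∧ S ⊆ (H : Set B)} H := by
  have hwf : WellFounded fun H K : {H : AddSubgroup B //
      (Set.univ : Set B).Definable₁ lang (H : Set B)} => H.1 < K.1 := by
    rw [wellFounded_iff_isEmpty_descending_chain]
    exact ⟨fun K => hB.not_strictAnti (fun n => (K.1 n).1) (fun n => (K.1 n).2) K.2⟩
  have htop : (Set.univ : Set B).Definable₁ lang ((⊤ : AddSubgroup B) : Set B) :=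
    Set.definable_univ
  obtain ⟨⟨H, hH⟩, hSH, hmin⟩ := hwf.has_min {H | S ⊆ (H.1 : Set B)}
    ⟨⟨⊤, htop⟩, fun _ _ => trivial⟩
  refine ⟨H, ⟨hH, hSH⟩, fun K ⟨hK, hSK⟩ => ?_⟩
  have hHK : (Set.univ : Set B).Definable₁ lang ((H ⊓ K : AddSubgroup B) : Set B) := by
    rw [AddSubgroup.coe_inf]
    exact Set.Definable.inter hH hK
  have h1 := hmin ⟨H ⊓ K, hHK⟩ fun x hx => ⟨hSH hx, hSK hx⟩
  by_contra hle
  exact h1 (inf_lt_left.2 hle)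

theorem IsStable.hullIsDefinable (hB : IsStable B) (hω : IsOmegaStable B) (S : Set B) :
    HullIsDefinable S :=
  hB.hullIsDefinable_of_isLeast (hω.exists_isLeast S)

end OmegaStable

end SkewBrace

namespace SkewBrace

/-! ### The `λ`-action, and definable normalizers, stabilizers and centralizers. -/

section Lambda

variable {B : Type u} [SkewBrace B]

theorem one_eq_zero : (1 : B) = 0 := by
  have h := skew_distrib (1 : B) 0 0
  simpa using h

theorem add_lam (a b : B) : a + lam a b = a * b := by
  simp [lam]

theorem lam_add (a b c : B) : lam a (b + c) = lam a b + lam a c := by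
  simp only [lam, skew_distrib, add_assoc]

/-- `λ_a` as an endomorphism of the additive group. -/
def lamHom (a : B) : B →+ B := AddMonoidHom.mk' (lam a) (lam_add a)

@[simp]
theorem lam_zero (a : B) : lam a 0 = 0 := (lamHom a).map_zero

theorem lam_neg (a b : B) : lam a (-b) = -lam a b := (lamHom a).map_neg b

/-- With `lam_add`, this makes `λ` an action of `(B, ∘)` on `(B, +)` by automorphisms. -/
theorem lam_mul (a b c : B) : lam (a * b) c = lam a (lam b c) := by
  have h : lam a (lam b c) = -lam a b + lam a (b * c) := by
    rw [show lam b c = -b + b * c from rfl, lam_add, lam_neg]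
  rw [h, lam, lam, lam, mul_assoc]
  simp [add_assoc]

@[simp]
theorem lam_one (b : B) : lam 1 b = b := by
  simp [lam, one_eq_zero]

@[simp]
theorem lam_inv_lam (a b : B) : lam a⁻¹ (lam a b) = b := by
  rw [← lam_mul, inv_mul_cancel, lam_one]

@[simp]
theorem lam_lam_inv (a b : B) : lam a (lam a⁻¹ b) = b := by
  rw [← lam_mul, mul_inv_cancel, lam_one]

/-- From `a⁻¹ + λ_{a⁻¹}(a) = a⁻¹ ∘ a = 0`; it serves to compare the two inverses modulo a subgroup.
-/
theorem inv_eq_neg_lam (a : B) : a⁻¹ = -lam a⁻¹ a := by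
  simp [lam, one_eq_zero]

/-- Conjugation in the additive group, as an endomorphism. -/
def conjHom (x : B) : B →+ B :=
  AddMonoidHom.mk' (fun z => x + z + -x) fun y z => by simp [add_assoc]

theorem mem_iff_lam_mem {L : AddSubgroup B} {T : Set B} (hT : ∀ a ∈ T, a⁻¹ ∈ T)
    (h : ∀ a ∈ T, ∀ x ∈ L, lam a x ∈ L) {a : B} (ha : a ∈ T) (x : B) : x ∈ L ↔ lam a x ∈ L :=
  ⟨h a ha x, fun hx => by simpa using h _ (hT a ha) _ hx⟩

theorem mem_iff_conj_mem {L T : AddSubgroup B} (h : ∀ y ∈ T, ∀ x ∈ L, y + x + -y ∈ L) {y : B}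
    (hy : y ∈ T) (x : B) : x ∈ L ↔ y + x + -y ∈ L :=
  ⟨h y hy x, fun hx => by simpa [add_assoc] using h _ (T.neg_mem hy) _ hx⟩

/-- The additive normalizer of `L`. -/
def addNormalizer (L : AddSubgroup B) : AddSubgroup B where
  carrier := {z | ∀ l, l ∈ L ↔ z + l + -z ∈ L}
  zero_mem' := by simp
  add_mem' {y z} hy hz l := by
    rw [hz l, hy]
    simp [add_assoc]
  neg_mem' {z} hz l := by
    rw [hz (-z + l + - -z)]
    simp [add_assoc]

theorem mem_addNormalizer {L : AddSubgroup B} {z : B} :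
    z ∈ addNormalizer L ↔ ∀ l, l ∈ L ↔ z + l + -z ∈ L := Iff.rfl

/-- The multiplicative stabilizer of `L` under `λ`. -/
def lamStabilizer (L : AddSubgroup B) : Subgroup B where
  carrier := {a | ∀ l, l ∈ L ↔ lam a l ∈ L}
  one_mem' := by simp
  mul_mem' {a b} ha hb l := by rw [hb l, ha, lam_mul]
  inv_mem' {a} ha l := by rw [ha (lam a⁻¹ l), lam_lam_inv]

theorem mem_lamStabilizer {L : AddSubgroup B} {a : B} :
    a ∈ lamStabilizer L ↔ ∀ l, l ∈ L ↔ lam a l ∈ L := Iff.rfl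

/-- The elements of the normalizer of `L` which `λ_a` fixes modulo `L`. -/
def lamFixed (L : AddSubgroup B) (a : B) : AddSubgroup B where
  carrier := {z | z ∈ addNormalizer L ∧ ast a z ∈ L}
  zero_mem' := ⟨zero_mem _, by simp [ast]⟩
  add_mem' {y z} hy hz := by
    refine ⟨add_mem hy.1 hz.1, ?_⟩
    -- `a ∗ ·` is additive only up to conjugation, which is why membership in the normalizer is part
    -- of the definition.
    have h : ast a (y + z) = ast a y + (y + ast a z + -y) := by
      simp [ast, lam_add, add_assoc]
    rw [h]
    exact add_mem hy.2 ((hy.1 _).1 hz.2)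
  neg_mem' {z} hz := by
    refine ⟨neg_mem hz.1, ?_⟩
    have h : ast a (-z) = -z + -ast a z + - -z := by
      simp [ast, lam_neg]
    rw [h]
    exact ((neg_mem hz.1 : -z ∈ addNormalizer L) _).1 (neg_mem hz.2)

theorem mem_lamFixed {L : AddSubgroup B} {a z : B} :
    z ∈ lamFixed L a ↔ z ∈ addNormalizer L ∧ ast a z ∈ L := Iff.rfl

/-- The elements of the stabilizer of `L` that act trivially on `M` modulo `L`. -/
def lamCentralizer (L M : AddSubgroup B) : Subgroup B where
  carrier := {a | a ∈ lamStabilizer L ∧ ∀ x ∈ M, ast a x ∈ L}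
  one_mem' := ⟨one_mem _, by simp [ast]⟩
  mul_mem' {a b} ha hb := by
    refine ⟨mul_mem ha.1 hb.1, fun x hx => ?_⟩
    have h : ast (a * b) x = lam a (ast b x) + ast a x := by
      simp [ast, lam_mul, lam_add, lam_neg, add_assoc]
    rw [h]
    exact add_mem ((ha.1 _).1 (hb.2 x hx)) (ha.2 x hx)
  inv_mem' {a} ha := by
    refine ⟨inv_mem ha.1, fun x hx => ?_⟩
    have h : ast a⁻¹ x = lam a⁻¹ (-ast a x) := by
      simp [ast, lam_add, lam_neg]
    rw [h]
    exact ((inv_mem ha.1 : a⁻¹ ∈ lamStabilizer L) _).1 (neg_mem (ha.2 x hx))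

theorem definable₁_addNormalizer {L : AddSubgroup B}
    (hL : (Set.univ : Set B).Definable₁ lang (L : Set B)) :
    (Set.univ : Set B).Definable₁ lang (addNormalizer L : Set B) := by
  refine DefinablePred.forall_snd (P := fun z l => l ∈ L ↔ z + l + -z ∈ L) ?_
  exact ((IsTermMap.var 1).mem hL).iff
    ((((IsTermMap.var 0).add (IsTermMap.var 1)).add (IsTermMap.var 0).neg).mem hL)

theorem definable₁_lamStabilizer {L : AddSubgroup B}
    (hL : (Set.univ : Set B).Definable₁ lang (L : Set B)) :
    (Set.univ : Set B).Definable₁ lang (lamStabilizer L : Set B) := by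
  refine DefinablePred.forall_snd (P := fun a l => l ∈ L ↔ lam a l ∈ L) ?_
  exact ((IsTermMap.var 1).mem hL).iff (((IsTermMap.var 0).lam (IsTermMap.var 1)).mem hL)

theorem definable₁_lamCentralizer {L M : AddSubgroup B}
    (hL : (Set.univ : Set B).Definable₁ lang (L : Set B))
    (hM : (Set.univ : Set B).Definable₁ lang (M : Set B)) :
    (Set.univ : Set B).Definable₁ lang (lamCentralizer L M : Set B) := by
  refine Set.Definable.inter (definable₁_lamStabilizer hL)
    (DefinablePred.forall_snd (P := fun a x => x ∈ M → ast a x ∈ L) ?_)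
  exact ((IsTermMap.var 1).mem hM).imp
    ((((IsTermMap.var 0).lam (IsTermMap.var 1)).add (IsTermMap.var 1).neg).mem hL)

/-- In a stable skew brace, the elements of the normalizer of a definable `L` on which all `λ_a`
with `a ∈ T` are trivial modulo `L` form a definable subgroup. -/
theorem IsStable.definable₁_iInf_lamFixed (hB : IsStable B) {L : AddSubgroup B}
    (hL : (Set.univ : Set B).Definable₁ lang (L : Set B)) (T : Set B) :
    (Set.univ : Set B).Definable₁ lang ((⨅ a ∈ T, lamFixed L a : AddSubgroup B) : Set B) := by
  -- One parameter suffices here; the second is a dummy.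
  have h := hB.definable_iInter (fun a _ => lamFixed L a)
    (((IsTermMap.var 2).mem (definable₁_addNormalizer hL)).and
      ((((IsTermMap.var 0).lam (IsTermMap.var 2)).add (IsTermMap.var 2).neg).mem hL))
    {p | p.1 ∈ T}
  convert h using 1
  ext x
  simp only [SetLike.mem_coe, AddSubgroup.mem_iInf]
  exact ⟨fun h p hp => h p.1 hp, fun h a ha => h (a, a) ha⟩

/-- In a stable skew brace, a definable subgroup `L` containing an invariant subgroup `J` contains
a definable invariant subgroup containing `J`. -/
theorem IsStable.exists_definable_invariant (hB : IsStable B) (C : Subgroup B)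
    {T J L : AddSubgroup B} (hTC : ∀ a ∈ C, ∀ x ∈ T, lam a x ∈ T)
    (hJC : ∀ a ∈ C, ∀ x ∈ J, lam a x ∈ J) (hJT : ∀ y ∈ T, ∀ x ∈ J, y + x + -y ∈ J)
    (hL : (Set.univ : Set B).Definable₁ lang (L : Set B)) (hJL : J ≤ L) :
    ∃ L' : AddSubgroup B, (Set.univ : Set B).Definable₁ lang (L' : Set B) ∧ J ≤ L' ∧ L' ≤ L ∧
      C ≤ lamStabilizer L' ∧ T ≤ addNormalizer L' := by
  have h := hB.definable_iInter (fun a y => L.comap ((conjHom y).comp (lamHom a)))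
    ((((IsTermMap.var 1).add ((IsTermMap.var 0).lam (IsTermMap.var 2))).add
      (IsTermMap.var 1).neg).mem hL) {p | p.1 ∈ C ∧ p.2 ∈ T}
  let L' : AddSubgroup B := ⨅ p ∈ {p : B × B | p.1 ∈ C ∧ p.2 ∈ T},
    L.comap ((conjHom p.2).comp (lamHom p.1))
  have hmem : ∀ z, z ∈ L' ↔ ∀ a ∈ C, ∀ y ∈ T, y + lam a z + -y ∈ L := by
    intro z
    simp only [L', AddSubgroup.mem_iInf, AddSubgroup.mem_comap]
    exact ⟨fun h a ha y hy => h (a, y) ⟨ha, hy⟩, fun h p hp => h p.1 hp.1 p.2 hp.2⟩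
  refine ⟨L', ?_, fun z hz => ?_, fun z hz => ?_, fun a ha => ?_, fun y hy => ?_⟩
  · convert h using 1
    ext x
    simp only [L', SetLike.mem_coe, AddSubgroup.mem_iInf]
    rfl
  · exact (hmem z).2 fun a ha y hy => hJL (hJT y hy _ (hJC a ha z hz))
  · simpa using (hmem z).1 hz 1 C.one_mem 0 T.zero_mem
  · refine mem_iff_lam_mem (T := C) (fun _ => C.inv_mem) (fun a ha z hz => ?_) ha
    refine (hmem _).2 fun b hb y hy => ?_
    rw [← lam_mul]
    exact (hmem z).1 hz _ (C.mul_mem hb ha) y hy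
  · refine mem_iff_conj_mem (T := T) (fun y hy z hz => (hmem _).2 fun b hb x hx => ?_) hy
    -- Applying `λ_b` and then conjugating by `x` turns conjugation by `y` into conjugation by `x +
    -- λ_b(y)`, which stays in `T` by its `λ`-invariance.
    have := (hmem z).1 hz b hb (x + lam b y) (T.add_mem hx (hTC b hb y hy))
    simpa [lam_add, lam_neg, add_assoc] using this

end Lambda

/-! ### Invariance of hulls, and exchanging additive and multiplicative subgroups. -/

section Hulls

variable {B : Type u} [SkewBrace B]

theorem subset_addHull (S : Set B) : S ⊆ addHull S :=
  fun _ hx => AddSubgroup.mem_sInf.2 fun _ hH => hH.2 hx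

theorem addHull_le {S : Set B} {H : AddSubgroup B}
    (hH : (Set.univ : Set B).Definable₁ lang (H : Set B)) (hS : S ⊆ H) : addHull S ≤ H :=
  sInf_le ⟨hH, hS⟩

theorem mulHull_le {S : Set B} {H : Subgroup B}
    (hH : (Set.univ : Set B).Definable₁ lang (H : Set B)) (hS : S ⊆ H) : mulHull S ≤ H :=
  sInf_le ⟨hH, hS⟩

theorem addHull_mono {S T : Set B} (h : S ⊆ T) : addHull S ≤ addHull T :=
  sInf_le_sInf fun _ hH => ⟨hH.1, h.trans hH.2⟩

theorem definable₁_zero : (Set.univ : Set B).Definable₁ lang ({0} : Set B) :=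
  Set.Definable.singleton_of_mem lang trivial

theorem addHull_bot : addHull ((⊥ : AddSubgroup B) : Set B) = ⊥ :=
  le_bot_iff.1 (addHull_le (by simpa using definable₁_zero) le_rfl)

/-- If `J` is `λ`-invariant under `C`, then its hull is `λ`-invariant under the hull of `C`. -/
theorem IsStable.lam_mem_addHull (hB : IsStable B) (C : Subgroup B) {J : AddSubgroup B}
    (hJC : ∀ a ∈ C, ∀ x ∈ J, lam a x ∈ J) {a x : B} (ha : a ∈ mulHull (C : Set B))
    (hx : x ∈ addHull (J : Set B)) : lam a x ∈ addHull (J : Set B) := by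
  refine AddSubgroup.mem_sInf.2 fun H ⟨hH, hJH⟩ => ?_
  -- Taking `T = ⊥` drops the normality requirement.
  obtain ⟨L, hL, hJL, hLH, hCL, -⟩ := hB.exists_definable_invariant C (T := ⊥) (J := J) (L := H)
    (by simp) hJC (by simp) hH hJH
  exact hLH ((mem_lamStabilizer.1 (mulHull_le (definable₁_lamStabilizer hL) hCL ha) x).1
    (addHull_le hL hJL hx))

/-- If `J` is normalized by `T`, then its hull is normalized by the hull of `T`. -/
theorem IsStable.conj_mem_addHull (hB : IsStable B) {T J : AddSubgroup B}
    (hJT : ∀ y ∈ T, ∀ x ∈ J, y + x + -y ∈ J) {y x : B} (hy : y ∈ addHull (T : Set B))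
    (hx : x ∈ addHull (J : Set B)) : y + x + -y ∈ addHull (J : Set B) := by
  refine AddSubgroup.mem_sInf.2 fun H ⟨hH, hJH⟩ => ?_
  obtain ⟨L, hL, hJL, hLH, -, hTL⟩ := hB.exists_definable_invariant ⊥ (T := T) (J := J) (L := H)
    (by simp) (by simp) hJT hH hJH
  exact hLH ((mem_addNormalizer.1 (addHull_le (definable₁_addNormalizer hL) hTL hy) x).1
    (addHull_le hL hJL hx))

/-- Let `J ≤ T` be left ideals of `C` with `J` normal in `T` and `C ∗ T ⊆ J`, and let `H` be a
definable subgroup containing `J`. Then `H` contains a definable subgroup `L ≥ J` for which there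
are definable subgroups `M ≥ T` and `D ≥ C` such that `M` normalizes `L`, and `D` stabilizes `L` and
acts trivially on `M` modulo `L`. -/
theorem IsStable.exists_definable_section (hB : IsStable B) (C : Subgroup B) {T J H : AddSubgroup B}
    (hTC : ∀ a ∈ C, ∀ x ∈ T, lam a x ∈ T) (hJC : ∀ a ∈ C, ∀ x ∈ J, lam a x ∈ J)
    (hJT : ∀ y ∈ T, ∀ x ∈ J, y + x + -y ∈ J) (hast : ∀ a ∈ C, ∀ x ∈ T, ast a x ∈ J)
    (hH : (Set.univ : Set B).Definable₁ lang (H : Set B)) (hJH : J ≤ H) :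
    ∃ (L M : AddSubgroup B) (D : Subgroup B), (Set.univ : Set B).Definable₁ lang (L : Set B) ∧
      (Set.univ : Set B).Definable₁ lang (M : Set B) ∧
      (Set.univ : Set B).Definable₁ lang (D : Set B) ∧
      J ≤ L ∧ L ≤ H ∧ T ≤ M ∧ C ≤ D ∧ L ≤ M ∧ M ≤ addNormalizer L ∧ D ≤ lamCentralizer L M := by
  obtain ⟨L, hL, hJL, hLH, hCL, hTL⟩ := hB.exists_definable_invariant C hTC hJC hJT hH hJH
  let M : AddSubgroup B := ⨅ a ∈ (C : Set B), lamFixed L a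
  have hmem : ∀ z, z ∈ M ↔ ∀ a ∈ C, z ∈ addNormalizer L ∧ ast a z ∈ L := by
    intro z
    simp only [M, AddSubgroup.mem_iInf, mem_lamFixed, SetLike.mem_coe]
  have hM := hB.definable₁_iInf_lamFixed hL (C : Set B)
  refine ⟨L, M, lamCentralizer L M, hL, hM, definable₁_lamCentralizer hL hM, hJL, hLH,
    fun z hz => (hmem z).2 fun a ha => ⟨hTL hz, hJL (hast a ha z hz)⟩,
    fun a ha => ⟨hCL ha, fun x hx => ((hmem x).1 hx a ha).2⟩,
    fun z hz => (hmem z).2 fun a ha => ⟨fun l => ?_, ?_⟩,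
    fun z hz => ((hmem z).1 hz 1 C.one_mem).1, le_rfl⟩
  · rw [AddSubgroup.add_mem_cancel_right _ (neg_mem hz), AddSubgroup.add_mem_cancel_left _ hz]
  · exact add_mem ((hCL ha z).1 hz) (neg_mem hz)

/-- If `C ∗ T ⊆ J`, with `J` normal in `T`, then this holds for the hulls. -/
theorem IsStable.ast_mem_addHull (hB : IsStable B) (C : Subgroup B) {T J : AddSubgroup B}
    (hTC : ∀ a ∈ C, ∀ x ∈ T, lam a x ∈ T) (hJC : ∀ a ∈ C, ∀ x ∈ J, lam a x ∈ J)
    (hJT : ∀ y ∈ T, ∀ x ∈ J, y + x + -y ∈ J) (hast : ∀ a ∈ C, ∀ x ∈ T, ast a x ∈ J) {a x : B}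
    (ha : a ∈ mulHull (C : Set B)) (hx : x ∈ addHull (T : Set B)) :
    ast a x ∈ addHull (J : Set B) := by
  refine AddSubgroup.mem_sInf.2 fun H ⟨hH, hJH⟩ => ?_
  obtain ⟨L, M, D, hL, hM, hD, hJL, hLH, hTM, hCD, -, -, hDC⟩ :=
    hB.exists_definable_section C hTC hJC hJT hast hH hJH
  exact hLH ((hDC (mulHull_le hD hCD ha)).2 x (addHull_le hM hTM hx))

/-- Since `x ∘ y = x + x ∗ y + y` with `x ∗ y ∈ L`, and `y` normalizes `L`, the two operations agree
modulo `L`. -/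
theorem add_mem_coset {L M : AddSubgroup B} {D : Subgroup B} (hD : D ≤ lamCentralizer L M)
    (hML : M ≤ addNormalizer L) {x y : B} (hx : x ∈ D) (hy : y ∈ M) :
    -(x + y) + x * y ∈ L := by
  have h : -(x + y) + x * y = -y + ast x y + - -y := by
    simp [ast, lam, add_assoc]
  rw [h]
  exact ((neg_mem (hML hy) : -y ∈ addNormalizer L) _).1 ((hD hx).2 y hy)

/-- In the situation of `IsStable.exists_definable_section`, a definable additive subgroup
containing `T` contains a definable multiplicative subgroup containing `T`. -/
theorem IsStable.exists_subgroup_le (hB : IsStable B) (C : Subgroup B) {T J K : AddSubgroup B}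
    (hTC : ∀ a ∈ C, ∀ x ∈ T, lam a x ∈ T) (hJC : ∀ a ∈ C, ∀ x ∈ J, lam a x ∈ J)
    (hJT : ∀ y ∈ T, ∀ x ∈ J, y + x + -y ∈ J) (hast : ∀ a ∈ C, ∀ x ∈ T, ast a x ∈ J)
    (hle : J ≤ T) (hTsub : (T : Set B) ⊆ C)
    (hK : (Set.univ : Set B).Definable₁ lang (K : Set B)) (hTK : T ≤ K) :
    ∃ E : Subgroup B, (Set.univ : Set B).Definable₁ lang (E : Set B) ∧ (T : Set B) ⊆ E ∧
      (E : Set B) ⊆ K := by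
  obtain ⟨L, M, D, hL, hM, hD, hJL, hLK, hTM, hCD, hLM, hML, hDC⟩ :=
    hB.exists_definable_section C hTC hJC hJT hast hK (hle.trans hTK)
  have hKM : ∀ {x y : B}, x ∈ D → x ∈ K ∧ x ∈ M → y ∈ K ∧ y ∈ M → x * y ∈ K ∧ x * y ∈ M := by
    intro x y hxD hx hy
    have h := add_mem_coset hDC hML hxD hy.2
    exact ⟨(K.add_mem_cancel_left (neg_mem (add_mem hx.1 hy.1))).1 (hLK h),
      (M.add_mem_cancel_left (neg_mem (add_mem hx.2 hy.2))).1 (hLM h)⟩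
  -- `D ∩ K ∩ M` works: products and inverses differ from elements of `K ∩ M` only by elements of
  -- `L`, which lies in both.
  let E : Subgroup B :=
    { carrier := {x | x ∈ D ∧ x ∈ K ∧ x ∈ M}
      one_mem' := ⟨one_mem _, by rw [one_eq_zero]; exact zero_mem _,
        by rw [one_eq_zero]; exact zero_mem _⟩
      mul_mem' := fun {x y} hx hy => ⟨mul_mem hx.1 hy.1, hKM hx.1 hx.2 hy.2⟩
      inv_mem' := fun {x} hx => by
        have hxi : x⁻¹ ∈ D := inv_mem hx.1
        have h : ast x⁻¹ x ∈ L := (hDC hxi).2 x hx.2.2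
        have h' : x⁻¹ = -(ast x⁻¹ x + x) := by
          conv_lhs => rw [inv_eq_neg_lam]
          simp [ast]
        refine ⟨hxi, ?_, ?_⟩
        · rw [h']
          exact neg_mem (add_mem (hLK h) hx.2.1)
        · rw [h']
          exact neg_mem (add_mem (hLM h) hx.2.2) }
  exact ⟨E, Set.Definable.inter hD (Set.Definable.inter hK hM),
    fun x hx => ⟨hCD (hTsub hx), hTK hx, hTM hx⟩, fun x hx => hx.2.1⟩

/-- In the situation of `IsStable.exists_definable_section`, a definable multiplicative subgroup
containing `T` contains a definable additive subgroup containing `T`, if this is so for `J`. -/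
theorem IsStable.exists_addSubgroup_le (hB : IsStable B) (C : Subgroup B) {T J : AddSubgroup B}
    (hTC : ∀ a ∈ C, ∀ x ∈ T, lam a x ∈ T) (hJC : ∀ a ∈ C, ∀ x ∈ J, lam a x ∈ J)
    (hJT : ∀ y ∈ T, ∀ x ∈ J, y + x + -y ∈ J) (hast : ∀ a ∈ C, ∀ x ∈ T, ast a x ∈ J)
    (hTsub : (T : Set B) ⊆ C) {K : Subgroup B}
    (hK : (Set.univ : Set B).Definable₁ lang (K : Set B)) (hTK : (T : Set B) ⊆ K)
    (hJ : ∃ H : AddSubgroup B, (Set.univ : Set B).Definable₁ lang (H : Set B) ∧ J ≤ H ∧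
      (H : Set B) ⊆ K) :
    ∃ E : AddSubgroup B, (Set.univ : Set B).Definable₁ lang (E : Set B) ∧ T ≤ E ∧
      (E : Set B) ⊆ K := by
  obtain ⟨H, hH, hJH, hHK⟩ := hJ
  obtain ⟨L, M, D, hL, hM, hD, hJL, hLH, hTM, hCD, hLM, hML, hDC⟩ :=
    hB.exists_definable_section C hTC hJC hJT hast hH hJH
  have hdM : ∀ {x d : B}, x ∈ M → -d + x ∈ L → d ∈ M := fun {x d} hx h => by
    have := add_mem hx (neg_mem (hLM h))
    simpa using this
  -- The elements of `M` congruent modulo `L` to an element of `D ∩ K`. Sums correspond to products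
  -- modulo `L`, so the multiplicative closure of `D ∩ K` gives additive closure.
  have hE : (Set.univ : Set B).Definable₁ lang
      {x | x ∈ M ∧ ∃ d, d ∈ D ∧ d ∈ K ∧ -d + x ∈ L} := by
    refine Set.Definable.inter hM
      (DefinablePred.exists_snd (P := fun x d => d ∈ D ∧ d ∈ K ∧ -d + x ∈ L) ?_)
    exact ((IsTermMap.var 1).mem hD).and (((IsTermMap.var 1).mem hK).and
      (((IsTermMap.var 1).neg.add (IsTermMap.var 0)).mem hL))
  let E : AddSubgroup B :=
    { carrier := {x | x ∈ M ∧ ∃ d, d ∈ D ∧ d ∈ K ∧ -d + x ∈ L}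
      zero_mem' := ⟨zero_mem _, 1, one_mem _, one_mem _, by simp [one_eq_zero]⟩
      add_mem' := by
        rintro x y ⟨hx, d, hdD, hdK, hdx⟩ ⟨hy, e, heD, heK, hey⟩
        refine ⟨add_mem hx hy, d * e, mul_mem hdD heD, mul_mem hdK heK, ?_⟩
        have h1 := add_mem_coset hDC hML hdD (hdM hy hey)
        have h2 : -(d * e) + (x + y) = -(-(d + e) + d * e) +
            ((-e + (-d + x) + - -e) + (-e + y)) := by
          simp [add_assoc]
        rw [h2]
        refine add_mem (neg_mem h1) (add_mem ?_ hey)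
        exact ((neg_mem (hML (hdM hy hey)) : -e ∈ addNormalizer L) _).1 hdx
      neg_mem' := by
        rintro x ⟨hx, d, hdD, hdK, hdx⟩
        have hdM' := hdM hx hdx
        refine ⟨neg_mem hx, d⁻¹, inv_mem hdD, inv_mem hdK, ?_⟩
        have h1 : ast d⁻¹ d ∈ L := (hDC (inv_mem hdD)).2 d hdM'
        have h2 : -d⁻¹ + -x = ast d⁻¹ d + (d + -(-d + x) + -d) := by
          have h3 : -d⁻¹ = ast d⁻¹ d + d := by
            conv_lhs => rw [inv_eq_neg_lam]
            simp [ast]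
          rw [h3]
          simp [add_assoc]
        rw [h2]
        exact add_mem h1 ((hML hdM' _).1 (neg_mem hdx)) }
  refine ⟨E, hE, fun x hx => ⟨hTM hx, x, hCD (hTsub hx), hTK hx, by simp⟩, ?_⟩
  rintro x ⟨hx, d, hdD, hdK, hdx⟩
  -- The correction `-d + x` becomes a right factor in `L`, because `D` stabilizes `L`, and `L ≤ H ⊆
  -- K`.
  have h1 : x = d * lam d⁻¹ (-d + x) := by
    rw [← add_lam, lam_lam_inv]
    simp
  change x ∈ K
  rw [h1]
  refine mul_mem hdK (hHK (hLH ?_))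
  exact ((hDC (inv_mem hdD)).1 _).1 hdx

end Hulls

end SkewBrace

namespace SkewBrace

/-! ### Chains of left ideals, with and without repetitions. -/

namespace SkewSubbrace

variable {B : Type u} [SkewBrace B]

theorem lam_mem (C : SkewSubbrace B) {a x : B} (ha : a ∈ C.carrier) (hx : x ∈ C.carrier) :
    lam a x ∈ C.carrier :=
  C.add_mem' (C.neg_mem' ha) (C.mul_mem' ha hx)

/-- A chain as in `IsLeftChain`, with repetitions allowed. -/
structure IsWeakChain (C : SkewSubbrace B) (k : ℕ) (I : ℕ → AddSubgroup B) : Prop where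
  zero : I 0 = ⊥
  top : I k = C.toAddSubgroup
  le_succ : ∀ n < k, I n ≤ I (n + 1)
  isLeftIdeal : ∀ n ≤ k, C.IsLeftIdeal (I n)
  ast_mem : ∀ n < k, ∀ a ∈ C.carrier, ∀ x ∈ I (n + 1), ast a x ∈ I n

variable {C : SkewSubbrace B} {k : ℕ} {I : ℕ → AddSubgroup B}

theorem IsLeftChain.isWeakChain (h : C.IsLeftChain k I) : C.IsWeakChain k I :=
  ⟨h.1, h.2.1, fun n hn => (h.2.2.1 n hn).le, h.2.2.2.1, h.2.2.2.2⟩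

theorem IsWeakChain.isLeftChain (h : C.IsWeakChain k I) (hne : ∀ n < k, I n ≠ I (n + 1)) :
    C.IsLeftChain k I :=
  ⟨h.zero, h.top, fun n hn => lt_of_le_of_ne (h.le_succ n hn) (hne n hn), h.isLeftIdeal, h.ast_mem⟩

/-- A repetition in a chain can be omitted. -/
theorem IsWeakChain.skip (h : C.IsWeakChain (k + 1) I) {n : ℕ} (hn : n < k + 1)
    (hI : I n = I (n + 1)) : C.IsWeakChain k fun i => if i ≤ n then I i else I (i + 1) where
  zero := by simpa using h.zero
  top := by
    split_ifs with hk
    · obtain rfl : k = n := by omega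
      rw [hI, h.top]
    · exact h.top
  le_succ i hi := by
    split_ifs with h1 h2 h2
    · exact h.le_succ i (by omega)
    · obtain rfl : i = n := by omega
      rw [hI]
      exact h.le_succ _ (by omega)
    · omega
    · exact h.le_succ _ (by omega)
  isLeftIdeal i hi := by
    split_ifs with h1
    · exact h.isLeftIdeal _ (by omega)
    · exact h.isLeftIdeal _ (by omega)
  ast_mem i hi a ha x hx := by
    split_ifs at hx ⊢ with h1 h2 h2
    · exact h.ast_mem i (by omega) a ha x hx
    · obtain rfl : i = n := by omega
      rw [hI]
      exact h.ast_mem _ (by omega) a ha x hx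
    · omega
    · exact h.ast_mem _ (by omega) a ha x hx

/-- A chain of strong left ideals with repetitions can be shortened to one without. -/
theorem IsWeakChain.exists_isStrongLeftChain (h : C.IsWeakChain k I)
    (hs : ∀ n ≤ k, C.IsStrongLeftIdeal (I n)) : ∃ j ≤ k, ∃ J, C.IsStrongLeftChain j J := by
  induction k generalizing I with
  | zero => exact ⟨0, le_rfl, I, h.isLeftChain (by simp), hs⟩
  | succ k ih =>
    by_cases hne : ∀ n < k + 1, I n ≠ I (n + 1)
    · exact ⟨k + 1, le_rfl, I, h.isLeftChain hne, hs⟩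
    · push Not at hne
      obtain ⟨n, hn, hI⟩ := hne
      obtain ⟨j, hj, J⟩ := ih (h.skip hn hI) fun i hi => by
        split_ifs
        · exact hs _ (by omega)
        · exact hs _ (by omega)
      exact ⟨j, hj.trans k.le_succ, J⟩

/-- The left series descends at least as fast as any chain, since each step adjoins only what `C ∗ I
(n + 1) ⊆ I n` forces. -/
theorem IsWeakChain.leftSeries_le (h : C.IsWeakChain k I) (m : ℕ) (hm : m ≤ k) :
    C.leftSeries m ≤ I (k - m) := by
  induction m with
  | zero => exact h.top.ge
  | succ m ih =>
    refine (AddSubgroup.closure_le _).2 ?_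
    rintro _ ⟨a, ha, x, hx, rfl⟩
    refine h.ast_mem _ (by omega) a ha x ?_
    have h1 : k - (m + 1) + 1 = k - m := by omega
    rw [h1]
    exact ih (by omega) hx

theorem IsWeakChain.leftSeries_eq_bot (h : C.IsWeakChain k I) : C.leftSeries k = ⊥ := by
  have h1 := h.leftSeries_le k le_rfl
  rwa [Nat.sub_self, h.zero, le_bot_iff] at h1

theorem IsWeakChain.mono (h : C.IsWeakChain k I) {n : ℕ} (hn : n ≤ k) : I n ≤ C.toAddSubgroup :=
  (h.isLeftIdeal n hn).1

/-! ### The left series as a chain. -/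

section LeftSeries

variable (C)

theorem isLeftIdeal_leftSeries (n : ℕ) : C.IsLeftIdeal (C.leftSeries n) := by
  induction n with
  | zero => exact ⟨le_rfl, fun a ha x hx => C.lam_mem ha hx⟩
  | succ n ih =>
    constructor
    · refine (AddSubgroup.closure_le _).2 ?_
      rintro _ ⟨a, ha, x, hx, rfl⟩
      exact ih.1 (add_mem (ih.2 a ha x hx) (neg_mem hx))
    · intro b hb
      change C.leftSeries (n + 1) ≤ (C.leftSeries (n + 1)).comap (lamHom b)
      refine (AddSubgroup.closure_le _).2 ?_
      rintro _ ⟨a, ha, x, hx, rfl⟩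
      -- The identity behind this is `λ_b(a ∗ x) = (b ∘ a ∘ b⁻¹) ∗ λ_b(x)`.
      refine AddSubgroup.subset_closure ⟨b * a * b⁻¹,
        C.mul_mem' (C.mul_mem' hb ha) (C.inv_mem' hb), lam b x, ih.2 b hb x hx, ?_⟩
      change _ = lam b _
      simp [ast, lam_mul, lam_add, lam_neg]

theorem ast_mem_leftSeries_succ {n : ℕ} {a x : B} (ha : a ∈ C.carrier)
    (hx : x ∈ C.leftSeries n) : ast a x ∈ C.leftSeries (n + 1) :=
  AddSubgroup.subset_closure ⟨a, ha, x, hx, rfl⟩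

theorem leftSeries_succ_le (n : ℕ) : C.leftSeries (n + 1) ≤ C.leftSeries n := by
  refine (AddSubgroup.closure_le _).2 ?_
  rintro _ ⟨a, ha, x, hx, rfl⟩
  exact add_mem ((C.isLeftIdeal_leftSeries n).2 a ha x hx) (neg_mem hx)

/-- Conjugates of generators stay inside because `y + a ∗ z - y = -(a ∗ y) + a ∗ (y + z)`. This
supplies the normality that the passage to hulls needs, with no strongness assumed. -/
theorem conj_mem_leftSeries_succ {n : ℕ} {x y : B} (hy : y ∈ C.leftSeries n)
    (hx : x ∈ C.leftSeries (n + 1)) : y + x + -y ∈ C.leftSeries (n + 1) := by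
  suffices h : C.leftSeries (n + 1) ≤ (C.leftSeries (n + 1)).comap (conjHom y) from h hx
  refine (AddSubgroup.closure_le _).2 ?_
  rintro _ ⟨a, ha, z, hz, rfl⟩
  change y + ast a z + -y ∈ C.leftSeries (n + 1)
  have h : y + ast a z + -y = -ast a y + ast a (y + z) := by
    simp [ast, lam_add, add_assoc]
  rw [h]
  exact add_mem (neg_mem (C.ast_mem_leftSeries_succ ha hy))
    (C.ast_mem_leftSeries_succ ha (add_mem hy hz))

theorem isWeakChain_leftSeries (h : C.leftSeries k = ⊥) :
    C.IsWeakChain k fun n => C.leftSeries (k - n) where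
  zero := h
  top := by
    rw [Nat.sub_self]
    rfl
  le_succ n hn := by
    have h1 : k - n = k - (n + 1) + 1 := by omega
    rw [h1]
    exact C.leftSeries_succ_le _
  isLeftIdeal n _ := C.isLeftIdeal_leftSeries _
  ast_mem n hn a ha x hx := by
    have h1 : k - n = k - (n + 1) + 1 := by omega
    rw [h1]
    exact C.ast_mem_leftSeries_succ ha hx

end LeftSeries

/-- Omitting a repetition would leave a chain of length `k - 1` and kill the left series one step
too early. -/
theorem IsWeakChain.isLeftChain_of_leftSeries_ne (h : C.IsWeakChain k I)
    (hk : ∀ j < k, C.leftSeries j ≠ ⊥) : C.IsLeftChain k I := by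
  refine h.isLeftChain fun n hn hI => ?_
  obtain ⟨k, rfl⟩ : ∃ l, k = l + 1 := ⟨k - 1, by omega⟩
  exact hk k k.lt_succ_self (h.skip hn hI).leftSeries_eq_bot

/-! ### Hulls of the members of a chain. -/

section Hulls

/-- The definable hulls of the terms of a chain of left ideals, each normal in the next. -/
theorem IsWeakChain.addHull_eq_mulHull (hB : IsStable B) (h : C.IsWeakChain k I)
    (hnorm : ∀ n < k, ∀ y ∈ I (n + 1), ∀ x ∈ I n, y + x + -y ∈ I n) {n : ℕ} (hn : n ≤ k) :
    (addHull (I n : Set B) : Set B) = mulHull (I n : Set B) := by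
  -- Induction along the chain: the additive subgroup found inside `K` for `I n` is the input for `I
  -- (n + 1)`.
  have key : ∀ n ≤ k, ∀ K : Subgroup B, (Set.univ : Set B).Definable₁ lang (K : Set B) →
      (I n : Set B) ⊆ K → ∃ E : AddSubgroup B, (Set.univ : Set B).Definable₁ lang (E : Set B) ∧
        I n ≤ E ∧ (E : Set B) ⊆ K := by
    intro n
    induction n with
    | zero =>
      intro _ K hK hIK
      refine ⟨⊥, by simpa using definable₁_zero, h.zero.le, ?_⟩
      rwa [← h.zero]
    | succ n ih =>
      intro hn K hK hIK
      have hle := h.le_succ n hn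
      refine hB.exists_addSubgroup_le C.toSubgroup (h.isLeftIdeal (n + 1) hn).2
        (h.isLeftIdeal n (by omega)).2 (hnorm n hn) (h.ast_mem n hn) (h.mono hn) hK hIK
        (ih (by omega) K hK (Set.Subset.trans hle hIK))
  refine Set.Subset.antisymm (fun x hx => ?_) (fun x hx => ?_)
  · refine Subgroup.mem_sInf.2 fun K ⟨hK, hIK⟩ => ?_
    obtain ⟨E, hE, hIE, hEK⟩ := key n hn K hK hIK
    exact hEK (addHull_le hE hIE hx)
  · refine AddSubgroup.mem_sInf.2 fun K ⟨hK, hIK⟩ => ?_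
    rcases n with _ | n
    · have h1 : mulHull (I 0 : Set B) ≤ ⊥ := by
        refine mulHull_le ?_ ?_
        · simpa [one_eq_zero] using definable₁_zero
        · rw [h.zero]
          simp [one_eq_zero]
      have h2 : x = 1 := h1 hx
      rw [h2, one_eq_zero]
      exact zero_mem K
    · obtain ⟨E, hE, hIE, hEK⟩ := hB.exists_subgroup_le C.toSubgroup
        (h.isLeftIdeal (n + 1) hn).2 (h.isLeftIdeal n (by omega)).2 (hnorm n hn) (h.ast_mem n hn)
        (h.le_succ n hn) (h.mono hn) hK hIK
      exact hEK (mulHull_le hE hIE hx)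

/-- The hulls of the terms of a chain of left ideals, each normal in the next, form a chain of left
ideals of the hull of the sub-brace. -/
theorem IsWeakChain.exists_hull (hB : IsStable B) (h : C.IsWeakChain k I)
    (hnorm : ∀ n < k, ∀ y ∈ I (n + 1), ∀ x ∈ I n, y + x + -y ∈ I n) :
    ∃ D : SkewSubbrace B, D.carrier = addHull C.carrier ∧ D.carrier = mulHull C.carrier ∧
      D.IsWeakChain k fun n => addHull (I n : Set B) := by
  have hC : (I k : Set B) = C.carrier := by
    rw [h.top]
    rfl
  have heq : (addHull C.carrier : Set B) = mulHull C.carrier := by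
    have := h.addHull_eq_mulHull hB hnorm le_rfl
    rwa [hC] at this
  have hmem : ∀ x, x ∈ addHull C.carrier ↔ x ∈ mulHull C.carrier := fun x => Set.ext_iff.1 heq x
  let D : SkewSubbrace B :=
    { addHull C.carrier with
      mul_mem' := fun {a b} ha hb => (hmem _).2 (mul_mem ((hmem a).1 ha) ((hmem b).1 hb))
      one_mem' := (hmem _).2 (one_mem _)
      inv_mem' := fun {a} ha => (hmem _).2 (inv_mem ((hmem a).1 ha)) }
  refine ⟨D, rfl, heq, ?_, ?_, fun n hn => addHull_mono (h.le_succ n hn), fun n hn => ⟨?_, ?_⟩, ?_⟩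
  · rw [h.zero, addHull_bot]
  · rw [hC]
  · refine addHull_mono ?_
    rw [← hC, h.top]
    exact h.mono hn
  · exact fun a ha x hx => hB.lam_mem_addHull C.toSubgroup (h.isLeftIdeal n hn).2 ((hmem a).1 ha) hx
  · exact fun n hn a ha x hx => hB.ast_mem_addHull C.toSubgroup (h.isLeftIdeal (n + 1) hn).2
      (h.isLeftIdeal n hn.le).2 (hnorm n hn) (h.ast_mem n hn) ((hmem a).1 ha) hx

end Hulls

/-! ### Transport of chains along elementary embeddings. -/

section Extensions

variable {B' : Type u} [SkewBrace B'] (j : B ↪ₑ[lang] B')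

theorem map_mul_embedding (x y : B) : j (x * y) = j x * j y :=
  j.map_fun mulSymbol ![x, y]

theorem map_lam_embedding (x y : B) : j (lam x y) = lam (j x) (j y) := by
  rw [lam, lam, ← map_mul_embedding]
  exact ((addHomOfEmbedding j).map_add _ _).trans
    (congrArg (· + j (x * y)) ((addHomOfEmbedding j).map_neg x))

theorem map_ast_embedding (x y : B) : j (ast x y) = ast (j x) (j y) := by
  rw [ast, ast, ← map_lam_embedding]
  exact ((addHomOfEmbedding j).map_add _ _).trans
    (congrArg (j (lam x y) + ·) ((addHomOfEmbedding j).map_neg y))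

/-- The image of a skew sub-brace in an elementary extension. -/
def map (C : SkewSubbrace B) : SkewSubbrace B' :=
  { C.toAddSubgroup.map (addHomOfEmbedding j) with
    mul_mem' := by
      rintro _ _ ⟨x, hx, rfl⟩ ⟨y, hy, rfl⟩
      exact ⟨x * y, C.mul_mem' hx hy, map_mul_embedding j x y⟩
    one_mem' := (C.toSubgroup.map (MonoidHom.mk' j (map_mul_embedding j))).one_mem
    inv_mem' := by
      rintro _ ⟨x, hx, rfl⟩
      exact ⟨x⁻¹, C.inv_mem' hx, (MonoidHom.mk' j (map_mul_embedding j)).map_inv x⟩ }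

theorem IsWeakChain.map (h : C.IsWeakChain k I) :
    (C.map j).IsWeakChain k fun n => (I n).map (addHomOfEmbedding j) where
  zero := by
    rw [h.zero, AddSubgroup.map_bot]
  top := by
    rw [h.top]
    rfl
  le_succ n hn := AddSubgroup.map_mono (h.le_succ n hn)
  isLeftIdeal n hn := by
    refine ⟨AddSubgroup.map_mono (h.mono hn), ?_⟩
    rintro _ ⟨a, ha, rfl⟩ _ ⟨x, hx, rfl⟩
    exact ⟨lam a x, (h.isLeftIdeal n hn).2 a ha x hx, map_lam_embedding j a x⟩
  ast_mem n hn := by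
    rintro _ ⟨a, ha, rfl⟩ _ ⟨x, hx, rfl⟩
    exact ⟨ast a x, h.ast_mem n hn a ha x hx, map_ast_embedding j a x⟩

theorem conj_mem_map {J T : AddSubgroup B} (h : ∀ y ∈ T, ∀ x ∈ J, y + x + -y ∈ J) :
    ∀ y ∈ T.map (addHomOfEmbedding j), ∀ x ∈ J.map (addHomOfEmbedding j),
      y + x + -y ∈ J.map (addHomOfEmbedding j) := by
  rintro _ ⟨y, hy, rfl⟩ _ ⟨x, hx, rfl⟩
  exact ⟨y + x + -y, h y hy x hx, by simp⟩

variable {D : SkewSubbrace B'}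

/-- This bounds the class of a larger sub-brace from below by that of `C`. -/
theorem leftSeries_map_le (hD : j '' C.carrier ⊆ D.carrier) (n : ℕ) :
    (C.leftSeries n).map (addHomOfEmbedding j) ≤ D.leftSeries n := by
  induction n with
  | zero => exact hD
  | succ n ih =>
    rw [AddSubgroup.map_le_iff_le_comap]
    refine (AddSubgroup.closure_le _).2 ?_
    rintro _ ⟨a, ha, x, hx, rfl⟩
    change j (ast a x) ∈ D.leftSeries (n + 1)
    rw [map_ast_embedding]
    exact D.ast_mem_leftSeries_succ (hD ⟨a, ha, rfl⟩) (ih ⟨x, hx, rfl⟩)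

theorem leftSeries_eq_bot_of_image_subset (hD : j '' C.carrier ⊆ D.carrier) {n : ℕ}
    (h : D.leftSeries n = ⊥) : C.leftSeries n = ⊥ := by
  have h1 := leftSeries_map_le j hD n
  rw [h, le_bot_iff] at h1
  exact (AddSubgroup.map_eq_bot_iff_of_injective _ j.injective).1 h1

/-- A chain of strong left ideals of `D` restricts to one of a smaller sub-brace. -/
theorem exists_isStrongLeftChain_of_image_subset (hD : j '' C.carrier ⊆ D.carrier)
    {J : ℕ → AddSubgroup B'} (h : D.IsWeakChain k J) (hs : ∀ n ≤ k, D.IsStrongLeftIdeal (J n)) :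
    ∃ l ≤ k, ∃ I, C.IsStrongLeftChain l I := by
  have hmem : ∀ {x}, x ∈ C.toAddSubgroup → j x ∈ D.carrier := fun {x} hx => hD ⟨x, hx, rfl⟩
  have hideal : ∀ n ≤ k,
      C.IsLeftIdeal ((J n).comap (addHomOfEmbedding j) ⊓ C.toAddSubgroup) := by
    refine fun n hn => ⟨inf_le_right, fun a ha x hx => ⟨?_, C.lam_mem ha hx.2⟩⟩
    change j (lam a x) ∈ J n
    rw [map_lam_embedding]
    exact (h.isLeftIdeal n hn).2 _ (hmem ha) _ hx.1
  refine IsWeakChain.exists_isStrongLeftChain (C := C)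
    (I := fun n => (J n).comap (addHomOfEmbedding j) ⊓ C.toAddSubgroup)
    ⟨?_, ?_, fun n hn => inf_le_inf_right _ (AddSubgroup.comap_mono (h.le_succ n hn)), hideal,
      fun n hn a ha x hx => ⟨?_, ?_⟩⟩ fun n hn => ⟨hideal n hn, fun a ha x hx => ⟨?_, ?_⟩⟩
  · rw [h.zero, eq_bot_iff]
    rintro x ⟨hx, -⟩
    have h1 : j x = 0 := hx
    have h2 : j 0 = 0 := (addHomOfEmbedding j).map_zero
    exact j.injective (h1.trans h2.symm)
  · rw [inf_eq_right, h.top]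
    exact fun x hx => hmem hx
  · change j (ast a x) ∈ J n
    rw [map_ast_embedding]
    exact h.ast_mem n hn _ (hmem ha) _ hx.1
  · exact C.add_mem' (C.lam_mem ha hx.2) (C.neg_mem' hx.2)
  · have h1 := (hs n hn).2 _ (hmem ha) _ hx.1
    have h2 : j a + addHomOfEmbedding j x + -j a = addHomOfEmbedding j (a + x + -a) := by
      simp only [map_add, map_neg]
      rfl
    rw [h2] at h1
    exact h1
  · exact C.add_mem' (C.add_mem' ha hx.2) (C.neg_mem' ha)

end Extensions

end SkewSubbrace

theorem IsStable.of_embedding {B B' : Type u} [SkewBrace B] [SkewBrace B'] (hB : IsStable B)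
    (j : B ↪ₑ[lang] B') : IsStable B' := by
  obtain ⟨κ, hκ, h⟩ := hB
  refine ⟨κ, hκ, fun A _ hA hc => h A ?_ hc⟩
  rwa [show lang.completeTheory B = lang.completeTheory B' from j.elementarilyEquivalent]

end SkewBrace


/-! ### The main theorem. -/

theorem mainTheorem8 {B : Type u} [SkewBrace B] (hB : IsStable B) (C : SkewSubbrace B) (k : ℕ) :
    -- left nilpotency
    (C.IsLeftNilpotentOfClass k →
      ∃ I : ℕ → AddSubgroup B, C.IsLeftChain k I ∧
        HullIsTypeDefinable C.carrier ∧
        (∀ n ≤ k, HullIsTypeDefinable (I n : Set B)) ∧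
        (IsOmegaStable B →
          HullIsDefinable C.carrier ∧ ∀ n ≤ k, HullIsDefinable (I n : Set B)) ∧
        -- in every elementary extension of `B`, in particular in `B` itself
        ∀ (B' : Type u) [SkewBrace B'] (j : B ↪ₑ[lang] B'),
          ∃ D : SkewSubbrace B',
            D.carrier = addHull (j '' C.carrier) ∧
            D.carrier = mulHull (j '' C.carrier) ∧
            D.IsLeftNilpotentOfClass k ∧
            (∀ n ≤ k, (addHull (j '' (I n : Set B)) : Set B') = mulHull (j '' (I n : Set B))) ∧
            D.IsLeftChain k (fun n => addHull (j '' (I n : Set B)))) ∧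
    -- strong left nilpotency
    (C.IsStronglyLeftNilpotentOfClass k →
      ∃ I : ℕ → AddSubgroup B, C.IsStrongLeftChain k I ∧
        HullIsTypeDefinable C.carrier ∧
        (∀ n ≤ k, HullIsTypeDefinable (I n : Set B)) ∧
        (IsOmegaStable B →
          HullIsDefinable C.carrier ∧ ∀ n ≤ k, HullIsDefinable (I n : Set B)) ∧
        ∀ (B' : Type u) [SkewBrace B'] (j : B ↪ₑ[lang] B'),
          ∃ D : SkewSubbrace B',
            D.carrier = addHull (j '' C.carrier) ∧
            D.carrier = mulHull (j '' C.carrier) ∧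
            D.IsStronglyLeftNilpotentOfClass k ∧
            (∀ n ≤ k, (addHull (j '' (I n : Set B)) : Set B') = mulHull (j '' (I n : Set B))) ∧
            D.IsStrongLeftChain k (fun n => addHull (j '' (I n : Set B)))) := by
  constructor
  · rintro ⟨hbot, hmin⟩
    have hI := C.isWeakChain_leftSeries hbot
    have hnorm : ∀ n < k, ∀ y ∈ C.leftSeries (k - (n + 1)), ∀ x ∈ C.leftSeries (k - n),
        y + x + -y ∈ C.leftSeries (k - n) := by
      intro n hn y hy x hx
      have h1 : k - n = k - (n + 1) + 1 := by omega
      rw [h1] at hx ⊢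
      exact C.conj_mem_leftSeries_succ hy hx
    refine ⟨fun n => C.leftSeries (k - n), hI.isLeftChain_of_leftSeries_ne hmin,
      hB.hullIsTypeDefinable _, fun n _ => hB.hullIsTypeDefinable _,
      fun hω => ⟨hB.hullIsDefinable hω _, fun n _ => hB.hullIsDefinable hω _⟩, fun B' _ j => ?_⟩
    have hB' := hB.of_embedding j
    have hI' := hI.map j
    have hnorm' := fun n hn => SkewSubbrace.conj_mem_map j (hnorm n hn)
    obtain ⟨D, hadd, hmul, hD⟩ := hI'.exists_hull hB' hnorm'
    have hCD : j '' C.carrier ⊆ D.carrier := by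
      rw [hadd]
      exact subset_addHull _
    -- The hull contains the image of `C`, so its class is not smaller; this also forces strictness
    -- of the chain of hulls.
    have hDmin : ∀ i < k, D.leftSeries i ≠ ⊥ := fun i hi h =>
      hmin i hi (SkewSubbrace.leftSeries_eq_bot_of_image_subset j hCD h)
    exact ⟨D, hadd, hmul, ⟨hD.leftSeries_eq_bot, hDmin⟩,
      fun n hn => hI'.addHull_eq_mulHull hB' hnorm' hn, hD.isLeftChain_of_leftSeries_ne hDmin⟩
  · rintro ⟨⟨I, hchain, hstrong⟩, hmin⟩
    have hI := hchain.isWeakChain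
    have hnorm : ∀ n < k, ∀ y ∈ I (n + 1), ∀ x ∈ I n, y + x + -y ∈ I n := fun n hn y hy =>
      (hstrong n hn.le).2 y (hI.mono hn hy)
    refine ⟨I, ⟨hchain, hstrong⟩,
      hB.hullIsTypeDefinable _, fun n _ => hB.hullIsTypeDefinable _,
      fun hω => ⟨hB.hullIsDefinable hω _, fun n _ => hB.hullIsDefinable hω _⟩, fun B' _ j => ?_⟩
    have hB' := hB.of_embedding j
    have hI' := hI.map j
    have hnorm' := fun n hn => SkewSubbrace.conj_mem_map j (hnorm n hn)
    obtain ⟨D, hadd, hmul, hD⟩ := hI'.exists_hull hB' hnorm'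
    have hCD : j '' C.carrier ⊆ D.carrier := by
      rw [hadd]
      exact subset_addHull _
    have hDstrong : ∀ n ≤ k, D.IsStrongLeftIdeal (addHull (j '' (I n : Set B))) := by
      refine fun n hn => ⟨hD.isLeftIdeal n hn, fun a ha x hx => ?_⟩
      rw [hadd] at ha
      exact hB'.conj_mem_addHull (SkewSubbrace.conj_mem_map j (hstrong n hn).2) ha hx
    -- A shorter strong chain of the hull, even with repetitions, would restrict to a shorter one of
    -- `C`. Allowing repetitions lets the same claim rule out equalities among the hulls below.
    have hDmin : ∀ i < k, ¬ ∃ J, D.IsWeakChain i J ∧ ∀ n ≤ i, D.IsStrongLeftIdeal (J n) := by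
      rintro i hi ⟨J, hJ, hJs⟩
      obtain ⟨l, hl, hex⟩ := SkewSubbrace.exists_isStrongLeftChain_of_image_subset j hCD hJ hJs
      exact hmin l (hl.trans_lt hi) hex
    have hDchain : D.IsLeftChain k fun n => addHull (j '' (I n : Set B)) := by
      refine hD.isLeftChain fun n hn heq => ?_
      obtain ⟨k, rfl⟩ : ∃ l, k = l + 1 := ⟨k - 1, by omega⟩
      refine hDmin k k.lt_succ_self ⟨_, hD.skip hn heq, fun i hi => ?_⟩
      split_ifs
      · exact hDstrong _ (by omega)
      · exact hDstrong _ (by omega)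
    exact ⟨D, hadd, hmul, ⟨⟨_, hDchain, hDstrong⟩,
      fun i hi ⟨J, hJ, hJs⟩ => hDmin i hi ⟨J, hJ.isWeakChain, hJs⟩⟩,
      fun n hn => hI'.addHull_eq_mulHull hB' hnorm' hn, hDchain, hDstrong⟩
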